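/- **Model.** A market with $N$ agents is described by order book states $u=(q^1,q^2,s)\in\mathbb U$, the set of triples with $q^1,q^2\in\mathbb N$ not both zero (best bid and best ask quantities) and $s\in\mathbb N$ the spread counted in ticks. An event is $e=(n,k,\sigma,b,\tilde u,u,a)\in E$: size $n\ge 1$, price level $k\in\mathbb N$, direction $\sigma\in\{+1,-1\}$, side $b\in\{1,2\}$ (bid, ask), state $\tilde u\in\mathbb U$ drawn in case of a depletion, state $u\in\mathbb U$ after the event, agent $a\in\{1,\dots,N\}$. A trajectory is a sequence $(T_i,X_i)_{i\in\mathbb Z}$ of times and events with $T_i<T_{i+1}$, $T_0\le 0<T_1$ and $T_i\to\pm\infty$ as $i\to\pm\infty$; $U_i\in\mathbb U$ is the state recorded in $X_i$, $U_{t^-}$ is the state after the last event strictly before $t$, and $\mathcal F_t=\sigma(\{T_i\in C\}\cap\{X_i\in B\}:\ i\in\mathbb Z,\ C\subset(-\infty,t]\text{ Borel},\ B\subset E)$. Let $\psi,\phi\ge 0$ be functions, measurable in their real arguments, and put $$\lambda_t(e)=\psi\Big(e,U_{t^-},t,\sum_{T_i<t}\phi(e,U_{t^-},t-T_i,X_i)\Big),\qquad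 t\ge 0,\ e\in E .$$ Call a probability law $\mathbb P$ of trajectories an *invariant law* for $(\psi,\phi)$ if: 1. a.s. the order book dynamics hold for all $i$: if $X_i=(n,k,\sigma,b,\tilde u,U_i,a)$, $U_{i-1}=(q^1,q^2,s)$, $\tilde u=(\tilde q^1,\tilde q^2,\tilde s)$, $\epsilon=\mathbf 1_{\{\sigma=-1,\,n\ge q^b\}}$, $\ell^1=0$, $\ell^2=s$, then $U_i$ has the spread $\mathbf 1_{\epsilon=0}s-\min(k,s-1)\mathbf 1_{\{b=1,k\ne 0\}}-(s-k)_+\mathbf 1_{\{b=2,k\ne s\}}+\mathbf 1_{\epsilon=1}\tilde s$ and, for $j=1,2$, the quantity $\mathbf 1_{\epsilon=0}q^j+n\mathbf 1_{\{b=j\}}\big(\mathbf 1_{\{\sigma=1,\,k=\ell^j\}}-\mathbf 1_{\{\sigma=-1,\,k=\ell^j,\,n<q^j\}}+\mathbf 1_{\{\sigma=1,\,k\notin\{0,s\}\}}\big)+\mathbf 1_{\epsilon=1}\tilde q^j$; 2. for every $t\ge0$ the sums defining $\lambda_t(e)$, $e\in E$, converge a.s.; 3. on $(0,\infty)$, the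 marked point process $(T_i,X_i)$ has the $(\mathcal F_t)$-intensity $\lambda$, that is, $\mathbb E\big[\sum_{T_i>0,\,X_i=e}C_{T_i}\big]=\mathbb E\big[\int_0^\infty C_s\lambda_s(e)\,ds\big]$ for all $e\in E$ and all predictable $C\ge0$; 4. it is stationary: the joint law of the trajectory seen from time $t$ and of $(\lambda_t(e))_{e\in E}$ does not depend on $t\ge 0$. **Statement.** Let $\mathbb P_\mu$ be the unique invariant law for $(\psi,\phi)$ (it is assumed that it exists and is unique). Let $Z$ be countable, $f:\mathbb U^{\mathbb N}\to Z$ measurable, $\zeta_t=f\big((U_i)_{T_i\le t}\big)$ (the states up to time $t$, most recent first), and let $z\neq z'$ in $Z$ with $\mathbb P_\mu[\zeta_0=z]>0$. Put $$N_t^{z,z'}=\sum_{i\ge1,\,T_i<t}\mathbf 1_{\{\zeta_{T_{i-1}}=z,\ \zeta_{T_i}=z'\}},\qquad t^z=\sum_{i\ge1,\,T_i<t}(T_i-T_{i-1})\mathbf 1_{\{\zeta_{T_{i-1}}=z\}},$$ $$Q(z,z')=\sum_{e\in E}\mathbb E_\mu\big[\lambda_0(e)\mathbf 1_{\{e\in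 E(z,z')\}}\,\big|\,\zeta_0=z\big]\in[0,\infty],$$ where $E(z,z')$ is the set of the events $e$ which, given the past of the book at time $0$ with $\zeta_0=z$, directly lead $\zeta$ to $z'$. Then $$\frac{N_t^{z,z'}}{t^{z}}\ \xrightarrow[t\to\infty]{}\ Q(z,z')\qquad \mathbb P_\mu\text{-a.s.}$$ No further assumption is made on the indicators $\mathbf 1_{\{\zeta_{T_{i-1}}=z,\zeta_{T_i}=z'\}}$, $i\ge1$; in particular the convergence holds when they form a stationary integrable sequence under $\mathbb P_\mu$. -/

import Mathlib

open MeasureTheory ProbabilityTheory Filter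
open scoped NNReal ENNReal Topology

noncomputable section

namespace OrderBook

/-! ### Order book states and events -/

/-- A state of the order book: quantity at the best bid, quantity at the best ask, and spread.
The spread is counted in ticks, that is `spread` stands for `spread * α₀` with `α₀` the tick size.
The states in which both quantities vanish are excluded. -/
@[ext] structure State where
  bidQty : ℕ
  askQty : ℕ
  spread : ℕ
  reachable : ¬(bidQty = 0 ∧ askQty = 0)

instance : MeasurableSpace State := ⊤

/-- The side of the book that an order modifies. -/
inductive Side
  | bid
  | ask
  deriving DecidableEq

/-- Whether an order provides or removes liquidity. -/
inductive Direction
  | provide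
  | remove
  deriving DecidableEq

/-- A market event in a market with `A` agents: order size, price level (in ticks above the best
bid), direction, side, the state drawn in case of a depletion, the state of the book after the
event, and the identity of the agent. -/
@[ext] structure Event (A : ℕ) where
  size : ℕ+
  level : ℕ
  dir : Direction
  side : Side
  redrawn : State
  state : State
  agent : Fin A

instance (A : ℕ) : MeasurableSpace (Event A) := ⊤

namespace State

/-- The quantity available at the best limit of a side. -/
def qty (u : State) : Side → ℕ
  | .bid => u.bidQty
  | .ask => u.askQty

/-- The price level of the best limit of a side, in ticks above the best bid. -/
def bestLevel (u : State) : Side → ℕ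
  | .bid => 0
  | .ask => u.spread

end State

namespace Event

variable {A : ℕ}

/-- The event `e` depletes a limit of the book when the book is in state `u`. -/
def Depletes (u : State) (e : Event A) : Prop :=
  e.dir = .remove ∧ u.qty e.side ≤ e.size

open Classical in
/-- Spread reduction (in ticks) by a buy limit order within the spread. -/
def tickBid (u : State) (e : Event A) : ℤ :=
  if e.side = .bid ∧ e.level ≠ 0 then min (e.level : ℤ) ((u.spread : ℤ) - 1) else 0

open Classical in
/-- Spread reduction (in ticks) by a sell limit order within the spread. -/
def tickAsk (u : State) (e : Event A) : ℤ :=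
  if e.side = .ask ∧ e.level ≠ u.spread then max ((u.spread : ℤ) - e.level) 0 else 0

open Classical in
/-- Quantity inserted at the best limit of side `b`. -/
def inserted (u : State) (e : Event A) (b : Side) : ℤ :=
  if e.dir = .provide ∧ e.level = u.bestLevel b ∧ e.side = b then (e.size : ℤ) else 0

open Classical in
/-- Quantity consumed, without depletion, at the best limit of side `b`. -/
def consumed (u : State) (e : Event A) (b : Side) : ℤ :=
  if e.dir = .remove ∧ e.level = u.bestLevel b ∧ e.side = b ∧ (e.size : ℕ) < u.qty b
    then (e.size : ℤ) else 0

open Classical in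
/-- Quantity inserted within the spread on side `b`. -/
def within (u : State) (e : Event A) (b : Side) : ℤ :=
  if e.dir = .provide ∧ e.level ≠ 0 ∧ e.level ≠ u.spread ∧ e.side = b then (e.size : ℤ) else 0

open Classical in
/-- The order book dynamics: the state recorded in the event `e` is the state that `e` produces
when it hits a book in state `u`. -/
def Follows (u : State) (e : Event A) : Prop :=
  (e.state.spread : ℤ) =
      (if e.Depletes u then 0 else (u.spread : ℤ)) - (e.tickBid u + e.tickAsk u)
        + (if e.Depletes u then (e.redrawn.spread : ℤ) else 0) ∧
  ∀ b : Side, (e.state.qty b : ℤ) =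
      (if e.Depletes u then 0 else (u.qty b : ℤ))
        + (e.inserted u b - e.consumed u b + e.within u b)
        + (if e.Depletes u then (e.redrawn.qty b : ℤ) else 0)

end Event

/-! ### Trajectories -/

/-- A trajectory of the market on the whole time axis: the `i`-th event `X i` happens at time
`T i`. The events are numbered so that `T 0 ≤ 0 < T 1`; the events with `i ≤ 0` form the past at
time `0`. Only finitely many events happen in a bounded time interval. -/
structure Path (A : ℕ) where
  T : ℤ → ℝ
  X : ℤ → Event A
  strictMono : StrictMono T
  T_zero_le : T 0 ≤ 0
  T_one_pos : 0 < T 1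
  tendsto_atTop : Tendsto T atTop atTop
  tendsto_atBot : Tendsto T atBot atBot

namespace Path

variable {A : ℕ}

/-- The σ-algebra generated by all the times `T i` and all the events `X i`. -/
instance : MeasurableSpace (Path A) :=
  MeasurableSpace.comap (fun w : Path A => (w.T, w.X)) inferInstance

lemma measurable_T (i : ℤ) : Measurable fun w : Path A => w.T i :=
  (measurable_pi_apply i).comp
    (measurable_fst.comp (comap_measurable (fun w : Path A => (w.T, w.X))))

lemma measurable_X (i : ℤ) : Measurable fun w : Path A => w.X i :=
  (measurable_pi_apply i).comp
    (measurable_snd.comp (comap_measurable (fun w : Path A => (w.T, w.X))))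

/-- The index of the last event at or before time `t`. -/
def idx (w : Path A) (t : ℝ) : ℤ := sSup {i : ℤ | w.T i ≤ t}

/-- The index of the last event strictly before time `t`. -/
def leftIdx (w : Path A) (t : ℝ) : ℤ := sSup {i : ℤ | w.T i < t}

lemma idx_nonempty (w : Path A) (t : ℝ) : {i : ℤ | w.T i ≤ t}.Nonempty :=
  (w.tendsto_atBot.eventually (eventually_le_atBot t)).exists

lemma idx_bddAbove (w : Path A) (t : ℝ) : BddAbove {i : ℤ | w.T i ≤ t} := by
  obtain ⟨k, hk⟩ := (w.tendsto_atTop.eventually (eventually_gt_atTop t)).exists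
  refine ⟨k, fun i hi => ?_⟩
  by_contra h
  have h1 := w.strictMono (not_le.mp h)
  have h2 : w.T i ≤ t := hi
  linarith

lemma T_idx_le (w : Path A) (t : ℝ) : w.T (w.idx t) ≤ t :=
  Int.csSup_mem (w.idx_nonempty t) (w.idx_bddAbove t)

lemma lt_T_idx_add_one (w : Path A) (t : ℝ) : t < w.T (w.idx t + 1) := by
  by_contra h
  have h1 : w.idx t + 1 ≤ w.idx t := le_csSup (w.idx_bddAbove t) (not_lt.mp h)
  omega

/-- The trajectory seen from time `t`: time `t` becomes the time origin. -/
def shift (t : ℝ) (w : Path A) : Path A where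
  T i := w.T (i + w.idx t) - t
  X i := w.X (i + w.idx t)
  strictMono := fun i j hij => by
    have := w.strictMono (show i + w.idx t < j + w.idx t by omega)
    simpa using this
  T_zero_le := by
    have := w.T_idx_le t
    simpa using this
  T_one_pos := by
    have := w.lt_T_idx_add_one t
    rw [add_comm] at this
    simpa using this
  tendsto_atTop := by
    simpa [sub_eq_add_neg] using tendsto_atTop_add_const_right atTop (-t)
      (w.tendsto_atTop.comp (tendsto_atTop_add_const_right atTop (w.idx t) tendsto_id))
  tendsto_atBot := by
    simpa [sub_eq_add_neg] using tendsto_atBot_add_const_right atBot (-t)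
      (w.tendsto_atBot.comp (tendsto_atBot_add_const_right atBot (w.idx t) tendsto_id))

/-- The state of the book after the `i`-th event. -/
def U (w : Path A) (i : ℤ) : State := (w.X i).state

/-- The sequence of the states of the book up to the `i`-th event, most recent state first. -/
def history (w : Path A) (i : ℤ) : ℕ → State := fun k => w.U (i - k)

/-- The history of the market: at time `t` the σ-algebra generated by the events
`{T n ∈ C} ∩ {X n ∈ B}` with `C` a Borel subset of `(-∞, t]`. -/
def filtration (A : ℕ) : Filtration ℝ≥0 (inferInstance : MeasurableSpace (Path A)) where
  seq t := MeasurableSpace.generateFrom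
    {s | ∃ (n : ℤ) (C : Set ℝ) (B : Set (Event A)), MeasurableSet C ∧ C ⊆ Set.Iic (t : ℝ) ∧
      MeasurableSet B ∧ s = {w | w.T n ∈ C ∧ w.X n ∈ B}}
  mono' := fun _ _ hst => MeasurableSpace.generateFrom_mono (by
    rintro _ ⟨n, C, B, hC, hCs, hB, rfl⟩
    exact ⟨n, C, B, hC, hCs.trans (Set.Iic_subset_Iic.mpr (by exact_mod_cast hst)), hB, rfl⟩)
  le' := fun _ => MeasurableSpace.generateFrom_le (by
    rintro _ ⟨n, C, B, hC, -, hB, rfl⟩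
    exact (measurable_T n hC).inter (measurable_X n hB))

end Path

/-! ### Intensity and invariant laws -/

section Intensity

variable {A : ℕ} (ψ : Event A → State → ℝ → ℝ≥0 → ℝ≥0) (φ : Event A → State → ℝ → Event A → ℝ≥0)

open Classical in
/-- The contribution `φ(e, U_{t-}, t - T_i, X_i)` of the `i`-th event to the excitation of `e` at
time `t`, for the events strictly before `t`. -/
def kernelTerm (w : Path A) (t : ℝ) (e : Event A) (i : ℤ) : ℝ≥0 :=
  if w.T i < t then φ e (w.U (w.leftIdx t)) (t - w.T i) (w.X i) else 0

/-- The arrival rate of `e` at time `t`: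
`λ_t(e) = ψ(e, U_{t-}, t, ∑_{T_i < t} φ(e, U_{t-}, t - T_i, X_i))`. -/
def intensity (w : Path A) (t : ℝ) (e : Event A) : ℝ≥0 :=
  ψ e (w.U (w.leftIdx t)) t (∑' i : ℤ, kernelTerm φ w t e i)

open Classical in
/-- Under `P`, after time `0`, the marked point process `(T_n, X_n)` has the intensity `intensity`
with respect to its own history: for every event `e` and every nonnegative predictable process `C`,
`E[∑_{T_n > 0, X_n = e} C_{T_n}] = E[∫_0^∞ C_s λ_s(e) ds]`. -/
def HasIntensity (P : Measure (Path A)) : Prop :=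
  ∀ (e : Event A) (C : ℝ≥0 → Path A → ℝ≥0∞),
    Measurable[(Path.filtration A).predictable] (Function.uncurry C) →
    ∫⁻ w, (∑' i : ℤ, if 0 < w.T i ∧ w.X i = e then C (w.T i).toNNReal w else 0) ∂P =
      ∫⁻ w, (∫⁻ s in Set.Ioi (0 : ℝ), C s.toNNReal w * (intensity ψ φ w s e : ℝ≥0∞)) ∂P

/-- `P` is the law of a stationary market with parameters `ψ` and `φ`: the book follows the order
book dynamics, the excitation sums converge, the events arrive with the intensity `intensity`, and
the joint law of the trajectory seen from time `t` and of the intensities at time `t` does not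
depend on `t ≥ 0`. -/
structure IsInvariantLaw (P : Measure (Path A)) : Prop where
  follows : ∀ᵐ w ∂P, ∀ i : ℤ, (w.X i).Follows (w.U (i - 1))
  summable : ∀ t : ℝ, 0 ≤ t → ∀ᵐ w ∂P, ∀ e, Summable (kernelTerm φ w t e)
  hasIntensity : HasIntensity ψ φ P
  invariant : ∀ t : ℝ, 0 ≤ t →
    IdentDistrib (fun w => (w.shift t, intensity ψ φ w t)) (fun w => (w, intensity ψ φ w 0)) P P

end Intensity

/-! ### The observed process, its transition rates and the estimator -/

section Estimator

variable {A : ℕ} {Z : Type*} (f : (ℕ → State) → Z)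

/-- The value `ζ_{T_i}` of the observed process right after the `i`-th event. -/
def zetaAt (w : Path A) (i : ℤ) : Z := f (w.history i)

/-- The observed process `ζ_t = f((U_i)_{T_i ≤ t})`. -/
def zeta (w : Path A) (t : ℝ) : Z := zetaAt f w (w.idx t)

/-- The sequence of states with `u` put in front of `h`. -/
def prepend (u : State) (h : ℕ → State) : ℕ → State
  | 0 => u
  | k + 1 => h k

/-- The events that would directly lead the observed process from its value at time `0` to `z`,
given the past of the book at time `0`: the new state is put in front of the past states. -/
def leadingTo (w : Path A) (z : Z) : Set (Event A) :=
  {e | f (prepend e.state (w.history (w.idx 0))) = z}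

open Classical in
/-- The transition rate `Q(z, z') = ∑_e E[λ_0(e) 1_{e leads from z to z'} | ζ_0 = z]`. -/
def Q (ψ : Event A → State → ℝ → ℝ≥0 → ℝ≥0) (φ : Event A → State → ℝ → Event A → ℝ≥0)
    (P : Measure (Path A)) (z z' : Z) : ℝ≥0∞ :=
  ∑' e : Event A, ∫⁻ w, (if e ∈ leadingTo f w z' then (intensity ψ φ w 0 e : ℝ≥0∞) else 0)
    ∂(P[|{w | zeta f w 0 = z}])

open Classical in
/-- The number `N_t^{z,z'}` of the transitions from `z` to `z'` that happen in `(0, t)`. -/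
def transitions (z z' : Z) (w : Path A) (t : ℝ) : ℝ :=
  ∑ᶠ (i : ℤ) (_ : 1 ≤ i ∧ w.T i < t),
    if zetaAt f w (i - 1) = z ∧ zetaAt f w i = z' then 1 else 0

open Classical in
/-- The time `t^z = ∑_{T_i < t} (T_i - T_{i-1}) 1_{ζ_{T_{i-1}} = z}` spent in `z`. -/
def timeSpent (z : Z) (w : Path A) (t : ℝ) : ℝ :=
  ∑ᶠ (i : ℤ) (_ : 1 ≤ i ∧ w.T i < t),
    if zetaAt f w (i - 1) = z then w.T i - w.T (i - 1) else 0

end Estimator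

end OrderBook

end

/-!
The number of transitions and the time spent in a state are additive functionals of the stationary
flow of shifts, so the theorem is an ergodic theorem, and it rests on two facts.

*Uniqueness implies ergodicity* (`IsInvariantLaw.eq_zero_or_ae_mem`). If a shift invariant event `B`
had a probability strictly between `0` and `1`, the law conditioned on `B` would be a second
invariant law. Stationarity passes to it because `B` is invariant; the intensity passes to it
because `B` agrees up to a null event with an event `B₀` of the past at time `0`, so that the
indicator of `B₀` is a predictable factor. To find `B₀`, approximate `B` by events of the past at
time `n` (the `L¹` martingale convergence theorem) and shift them back by `n`.

*The ergodic theorem* (`ae_tendsto_div_of_cocycle`). The shift by one unit of time need not be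
ergodic, only the whole flow is, and the mean number of transitions may be infinite. The events
that the upper or lower growth rate passes a given level are invariant under the whole flow, hence
trivial, and covering orbits by segments along which the average is large or small
(`le_lintegral_of_le_birkhoffSum`, `lintegral_le_of_birkhoffSum_le`) compares the level with the
mean.

The mean time spent in `z` per unit of time is the probability of `ζ_0 = z`
(`lintegral_occupation_one`). The mean number of transitions is computed by testing the intensity
against the predictable indicators that an event leads from `z` to `z'`; stationarity, which holds
jointly for the trajectory and the arrival rates, turns the result into the numerator of `Q`
(`lintegral_jumpCount_one`, `Q_eq_div`). Finally, the estimator is constant between two events, and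
along the times of the events it is the quotient of the two functionals, up to a bounded term from
the holding interval that contains `0` (`transitions_eq_jumpCount`, `timeSpent_eq_occupation`).
-/

namespace OrderBook

/-! ### Ergodic averages over a map -/

section Ergodic

variable {Ω : Type*} [MeasurableSpace Ω] {μ : Measure Ω} {T : Ω → Ω} {f : Ω → ℝ≥0∞}

lemma measurable_birkhoffSum (hT : Measurable T) (hf : Measurable f) (n : ℕ) :
    Measurable (birkhoffSum T f n) := by
  unfold birkhoffSum
  exact Finset.measurable_sum _ fun j _ => hf.comp (hT.iterate j)

lemma lintegral_birkhoffSum (hT : MeasurePreserving T μ μ) (hf : Measurable f) (n : ℕ) :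
    ∫⁻ w, birkhoffSum T f n w ∂μ = n * ∫⁻ w, f w ∂μ := by
  unfold birkhoffSum
  rw [lintegral_finsetSum (f := fun j w => f (T^[j] w)) _
    fun j _ => hf.comp (hT.measurable.iterate j)]
  simp [(hT.iterate _).lintegral_comp hf]

lemma le_of_forall_natCast_mul_le {a b c : ℝ≥0∞} (hb : b ≠ ⊤)
    (h : ∀ n : ℕ, n * c ≤ n * a + b) : c ≤ a := by
  by_contra! hac
  obtain ⟨d, had, hdc⟩ := exists_between hac
  have hd : d ≠ ⊤ := hdc.ne_top
  have ha : a ≠ ⊤ := had.ne_top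
  lift d to ℝ≥0 using hd
  lift a to ℝ≥0 using ha
  lift b to ℝ≥0 using hb
  have had' : (a : ℝ) < d := by exact_mod_cast had
  obtain ⟨n, hn⟩ := exists_nat_gt ((b : ℝ) / (d - a))
  rw [div_lt_iff₀ (by linarith)] at hn
  have h1 : (n : ℝ≥0∞) * d ≤ n * a + b := le_trans (by gcongr) (h n)
  have h2 : (n : ℝ) * d ≤ n * a + b := by exact_mod_cast h1
  nlinarith

/-- If almost every point has an initial segment of its orbit along which the average of `f` is
at least `c`, then so is the integral of `f`. Such segments of length at most `M` are laid end to
end; the points without one are few and are compensated by adding `c` to `f` there. -/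
lemma le_lintegral_of_le_birkhoffSum [IsProbabilityMeasure μ] (hT : MeasurePreserving T μ μ)
    (hf : Measurable f) {c : ℝ≥0∞} (hc : c ≠ ⊤)
    (h : ∀ᵐ w ∂μ, ∃ n : ℕ, 1 ≤ n ∧ n * c ≤ birkhoffSum T f n w) : c ≤ ∫⁻ w, f w ∂μ := by
  set E : ℕ → Set Ω := fun M => ⋃ n ∈ Finset.Icc 1 M, {w | n * c ≤ birkhoffSum T f n w} with hE
  have hEm : ∀ M, MeasurableSet (E M) := fun M =>
    Finset.measurableSet_biUnion _ fun n _ =>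
      measurableSet_le measurable_const (measurable_birkhoffSum hT.measurable hf n)
  have hmemE : ∀ M w, w ∈ E M ↔ ∃ n : ℕ, 1 ≤ n ∧ n ≤ M ∧ n * c ≤ birkhoffSum T f n w := by
    intro M w; simp [hE, and_assoc]
  -- `E M`: the points with such a segment of length at most `M`
  set g : ℕ → Ω → ℝ≥0∞ := fun M => f + (E M)ᶜ.indicator fun _ => c with hg
  have hgm : ∀ M, Measurable (g M) := fun M =>
    hf.add (measurable_const.indicator (hEm M).compl)
  have hfg : ∀ M n w, birkhoffSum T f n w ≤ birkhoffSum T (g M) n w := by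
    intro M n w
    exact Finset.sum_le_sum fun j _ => by simp [hg]
  -- the segments leave at most `M` of the `L` steps uncovered, at the end
  have key : ∀ (M L : ℕ) (w : Ω), L * c ≤ birkhoffSum T (g M) L w + M * c := by
    intro M L
    induction L using Nat.strong_induction_on with
    | _ L ih =>
      intro w
      rcases le_or_gt L M with hLM | hLM
      · exact le_add_left (by gcongr)
      by_cases hw : w ∈ E M
      · obtain ⟨n, hn1, hnM, hn⟩ := (hmemE M w).1 hw
        obtain ⟨k, rfl⟩ := Nat.exists_eq_add_of_le (hnM.trans hLM.le)
        have := ih k (by omega) (T^[n] w)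
        rw [birkhoffSum_add, Nat.cast_add, add_mul, add_assoc]
        exact add_le_add (hn.trans (hfg M n w)) this
      · obtain ⟨k, rfl⟩ := Nat.exists_eq_add_of_le (show 1 ≤ L by omega)
        have := ih k (by omega) (T^[1] w)
        rw [birkhoffSum_add, Nat.cast_add, add_mul, add_assoc]
        refine add_le_add ?_ this
        simp [hg, hw]
  have hbound : ∀ M, c ≤ ∫⁻ w, f w ∂μ + c * μ (E M)ᶜ := by
    intro M
    have h1 : ∫⁻ w, g M w ∂μ = ∫⁻ w, f w ∂μ + c * μ (E M)ᶜ := by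
      simp only [hg, Pi.add_apply]
      rw [lintegral_add_left hf, lintegral_indicator_const (hEm M).compl]
    rw [← h1]
    refine le_of_forall_natCast_mul_le (b := M * c) (ENNReal.mul_ne_top (by simp) hc) fun L => ?_
    rw [← lintegral_birkhoffSum hT (hgm M)]
    calc (L : ℝ≥0∞) * c = ∫⁻ _, L * c ∂μ := by simp
      _ ≤ ∫⁻ w, (birkhoffSum T (g M) L w + M * c) ∂μ := lintegral_mono fun w => key M L w
      _ = _ := by
        rw [lintegral_add_right _ measurable_const]; simp
  have hlim : Tendsto (fun M => μ (E M)ᶜ) atTop (𝓝 0) := by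
    have hanti : Antitone fun M => (E M)ᶜ := by
      intro M M' hM w hw hw'
      obtain ⟨n, h1, h2, h3⟩ := (hmemE M w).1 hw'
      exact hw ((hmemE M' w).2 ⟨n, h1, h2.trans hM, h3⟩)
    have hz : μ (⋂ M, (E M)ᶜ) = 0 := by
      refine measure_mono_null ?_ (ae_iff.1 h)
      intro w hw ⟨n, hn1, hn⟩
      exact Set.mem_iInter.1 hw n ((hmemE n w).2 ⟨n, hn1, le_rfl, hn⟩)
    rw [← hz]
    exact tendsto_measure_iInter_atTop (fun M => (hEm M).compl.nullMeasurableSet) hanti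
      ⟨0, measure_ne_top _ _⟩
  have hlim2 : Tendsto (fun M => ∫⁻ w, f w ∂μ + c * μ (E M)ᶜ) atTop (𝓝 (∫⁻ w, f w ∂μ)) := by
    simpa using tendsto_const_nhds.add (ENNReal.Tendsto.const_mul hlim (Or.inr hc))
  exact ge_of_tendsto' hlim2 hbound

/-- If almost every point has an initial segment of its orbit along which the average of `f` is
at most `c`, then so is the integral of `f`: such segments of length at most `M` are laid end to
end, for `f` truncated at height `M` and set to `0` at the points without one. -/
lemma lintegral_le_of_birkhoffSum_le [IsProbabilityMeasure μ] (hT : MeasurePreserving T μ μ)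
    (hf : Measurable f) (hfin : ∀ w, f w ≠ ⊤) {c : ℝ≥0∞}
    (h : ∀ᵐ w ∂μ, ∃ n : ℕ, 1 ≤ n ∧ birkhoffSum T f n w ≤ n * c) : ∫⁻ w, f w ∂μ ≤ c := by
  set E : ℕ → Set Ω := fun M => ⋃ n ∈ Finset.Icc 1 M, {w | birkhoffSum T f n w ≤ n * c} with hE
  have hEm : ∀ M, MeasurableSet (E M) := fun M =>
    Finset.measurableSet_biUnion _ fun n _ =>
      measurableSet_le (measurable_birkhoffSum hT.measurable hf n) measurable_const
  have hmemE : ∀ M w, w ∈ E M ↔ ∃ n : ℕ, 1 ≤ n ∧ n ≤ M ∧ birkhoffSum T f n w ≤ n * c := by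
    intro M w; simp [hE, and_assoc]
  set g : ℕ → Ω → ℝ≥0∞ := fun M => (E M).indicator fun w => min (f w) M with hg
  have hgm : ∀ M, Measurable (g M) := fun M => (hf.min measurable_const).indicator (hEm M)
  have hgf : ∀ M w, g M w ≤ f w := fun M w =>
    Set.indicator_apply_le' (fun _ => min_le_left _ _) fun _ => zero_le
  have hgM : ∀ M w, g M w ≤ M := fun M w =>
    Set.indicator_apply_le' (fun _ => min_le_right _ _) fun _ => zero_le
  -- at most `M` steps at the end are uncovered, and `g M ≤ M` there; this is why `f` is truncated
  have key : ∀ (M L : ℕ) (w : Ω), birkhoffSum T (g M) L w ≤ L * c + M * M := by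
    intro M L
    induction L using Nat.strong_induction_on with
    | _ L ih =>
      intro w
      rcases le_or_gt L M with hLM | hLM
      · refine le_add_left ?_
        calc birkhoffSum T (g M) L w ≤ ∑ _j ∈ Finset.range L, (M : ℝ≥0∞) :=
              Finset.sum_le_sum fun j _ => hgM M _
          _ = L * M := by simp
          _ ≤ M * M := by gcongr
      by_cases hw : w ∈ E M
      · obtain ⟨n, hn1, hnM, hn⟩ := (hmemE M w).1 hw
        obtain ⟨k, rfl⟩ := Nat.exists_eq_add_of_le (hnM.trans hLM.le)
        have := ih k (by omega) (T^[n] w)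
        rw [birkhoffSum_add, Nat.cast_add, add_mul, add_assoc]
        refine add_le_add (le_trans ?_ hn) this
        exact Finset.sum_le_sum fun j _ => hgf M _
      · obtain ⟨k, rfl⟩ := Nat.exists_eq_add_of_le (show 1 ≤ L by omega)
        have := ih k (by omega) (T^[1] w)
        rw [birkhoffSum_add, Nat.cast_add, add_mul, add_assoc]
        refine add_le_add ?_ this
        simp [hg, hw]
  have hbound : ∀ M, ∫⁻ w, g M w ∂μ ≤ c := by
    intro M
    refine le_of_forall_natCast_mul_le (b := M * M) (ENNReal.mul_ne_top (by simp) (by simp))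
      fun L => ?_
    rw [← lintegral_birkhoffSum hT (hgm M)]
    calc _ ≤ ∫⁻ _, (L * c + M * M) ∂μ := lintegral_mono fun w => key M L w
      _ = _ := by simp
  have hlim : ∀ᵐ w ∂μ, Tendsto (fun M => g M w) atTop (𝓝 (f w)) := by
    filter_upwards [h] with w ⟨n, hn1, hn⟩
    obtain ⟨K, hK⟩ := ENNReal.exists_nat_gt (hfin w)
    refine tendsto_const_nhds.congr' ?_
    filter_upwards [eventually_ge_atTop (max n K)] with M hM
    have hw : w ∈ E M := (hmemE M w).2 ⟨n, hn1, (le_max_left _ _).trans hM, hn⟩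
    have hK' : f w ≤ M := hK.le.trans (by exact_mod_cast (le_max_right n K).trans hM)
    simp [hg, hw, hK']
  have hmono : ∀ᵐ w ∂μ, Monotone fun M => g M w := by
    refine ae_of_all _ fun w M M' hM => ?_
    by_cases hw : w ∈ E M
    · obtain ⟨n, h1, h2, h3⟩ := (hmemE M w).1 hw
      have hw' : w ∈ E M' := (hmemE M' w).2 ⟨n, h1, h2.trans hM, h3⟩
      simp only [hg, Set.indicator_of_mem hw, Set.indicator_of_mem hw']
      gcongr
    · simp [hg, hw]
  exact le_of_tendsto' (lintegral_tendsto_of_tendsto_of_monotone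
    (fun M => (hgm M).aemeasurable) hmono hlim) hbound

end Ergodic

/-! ### Additive functionals of a flow -/

section Flow

lemma exists_add_le_mul {q q' : ℝ} (hq : q < q') (b : ℝ) :
    ∃ N : ℕ, ∀ x : ℝ, N ≤ x → q * x + b ≤ q' * x := by
  obtain ⟨N, hN⟩ := exists_nat_ge (b / (q' - q))
  refine ⟨N, fun x hx => ?_⟩
  have : b ≤ x * (q' - q) := (div_le_iff₀ (by linarith)).1 (hN.trans hx)
  linarith

/-- The condition `c < limsup u n / n` is stable under a shift of `u` in time and value. -/
lemma frequently_mul_lt_of_le {u v : ℕ → ℝ} {c b : ℝ} {k : ℕ} (h : ∀ n, u n ≤ v (n + k) + b)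
    (hu : ∃ q : ℚ, c < q ∧ ∃ᶠ n : ℕ in atTop, q * n < u n) :
    ∃ q : ℚ, c < q ∧ ∃ᶠ n : ℕ in atTop, q * n < v n := by
  obtain ⟨q, hcq, hq⟩ := hu
  obtain ⟨q', hcq', hq'⟩ := exists_rat_btwn hcq
  refine ⟨q', hcq', ?_⟩
  obtain ⟨N, hN⟩ := exists_add_le_mul hq' (q' * k + b)
  rw [frequently_atTop] at hq ⊢
  intro M
  obtain ⟨n, hn, hlt⟩ := hq (max M N)
  refine ⟨n + k, by omega, ?_⟩
  have h1 := hN n (by exact_mod_cast (le_max_right M N).trans hn)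
  have h2 := h n
  push_cast
  linarith

/-- The condition `liminf u n / n < c` is stable under a shift of `u` in time and value. -/
lemma frequently_lt_mul_of_le {u v : ℕ → ℝ} {c b : ℝ} {k : ℕ} (h : ∀ n, v n ≤ u (n + k) + b)
    (hu : ∃ q : ℚ, (q : ℝ) < c ∧ ∃ᶠ n : ℕ in atTop, u n < q * n) :
    ∃ q : ℚ, (q : ℝ) < c ∧ ∃ᶠ n : ℕ in atTop, v n < q * n := by
  obtain ⟨q, hcq, hq⟩ := hu
  obtain ⟨q', hq', hcq'⟩ := exists_rat_btwn hcq
  refine ⟨q', hcq', ?_⟩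
  obtain ⟨N, hN⟩ := exists_add_le_mul hq' (q * k + b)
  rw [frequently_atTop] at hq ⊢
  intro M
  obtain ⟨n, hn, hlt⟩ := hq (max M N + k)
  obtain ⟨m, rfl⟩ := Nat.exists_eq_add_of_le' (show k ≤ n by omega)
  refine ⟨m, by omega, ?_⟩
  have h1 := hN m (by exact_mod_cast (show N ≤ m by omega))
  have h2 := h m
  push_cast at hlt
  linarith

variable {Ω : Type*} [MeasurableSpace Ω] {μ : Measure Ω}

lemma measurableSet_setOf_frequently_nat {p : ℕ → Ω → Prop}
    (hp : ∀ n, MeasurableSet {w | p n w}) : MeasurableSet {w | ∃ᶠ n in atTop, p n w} := by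
  simp only [frequently_atTop, Set.ofPred_forall, Set.ofPred_exists, Set.ofPred_and]
  exact MeasurableSet.iInter fun N => MeasurableSet.iUnion fun n =>
    (MeasurableSet.const _).inter (hp n)

/-- **Pointwise ergodic theorem for additive functionals of a flow.** Only sets invariant under
the whole flow are assumed to be trivial, and the mean of `F 1` may be infinite. -/
theorem ae_tendsto_div_of_cocycle [IsProbabilityMeasure μ] {θ : ℝ → Ω → Ω}
    (hθ : MeasurePreserving (θ 1) μ μ)
    (herg : ∀ B : Set Ω, MeasurableSet B → (∀ t, 0 ≤ t → θ t ⁻¹' B = B) →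
      μ B = 0 ∨ ∀ᵐ w ∂μ, w ∈ B)
    {F : ℝ → Ω → ℝ≥0∞} (hF : ∀ t, Measurable (F t)) (hfin : ∀ t w, F t w ≠ ⊤)
    (hzero : ∀ w, F 0 w = 0)
    (hadd : ∀ s t w, 0 ≤ s → 0 ≤ t → F (s + t) w = F s w + F t (θ s w)) :
    ∀ᵐ w ∂μ, Tendsto (fun t : ℝ => F t w / ENNReal.ofReal t) atTop (𝓝 (∫⁻ w, F 1 w ∂μ)) := by
  set m := ∫⁻ w, F 1 w ∂μ with hm
  have hmono : ∀ w s t, 0 ≤ s → s ≤ t → F s w ≤ F t w := by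
    intro w s t hs hst
    have := hadd s (t - s) w hs (by linarith)
    rw [add_sub_cancel] at this
    rw [this]; exact le_self_add
  have hbirk : ∀ (n : ℕ) w, F n w = birkhoffSum (θ 1) (F 1) n w := by
    intro n
    induction n with
    | zero => simp [hzero]
    | succ n ih =>
      intro w
      rw [birkhoffSum_succ', ← ih, Nat.cast_succ, add_comm (n : ℝ),
        hadd _ _ _ zero_le_one (by simp)]
  set G : Ω → ℕ → ℝ := fun w n => (F n w).toReal with hG
  have hGF : ∀ w n, ENNReal.ofReal (G w n) = F n w := fun w n => ENNReal.ofReal_toReal (hfin _ _)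
  have hGm : ∀ n, Measurable fun w => G w n := fun n => (hF n).ennreal_toReal
  -- shifting the origin of time changes `G` only by a shift of `n` and a constant
  have hG1 : ∀ t, 0 ≤ t → ∀ w n, G w n ≤ G (θ t w) (n + ⌈t⌉₊) + (F t w).toReal := by
    intro t ht w n
    rw [hG]
    simp only
    rw [← ENNReal.toReal_add (hfin _ _) (hfin _ _)]
    refine ENNReal.toReal_mono (by simp [hfin]) ?_
    rw [add_comm, ← hadd _ _ _ ht (by positivity)]
    refine hmono _ _ _ (by positivity) ?_
    push_cast; nlinarith [Nat.le_ceil t]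
  have hG2 : ∀ t, 0 ≤ t → ∀ w n, G (θ t w) n ≤ G w (n + ⌈t⌉₊) + 0 := by
    intro t ht w n
    rw [hG, add_zero]
    refine ENNReal.toReal_mono (hfin _ _) ?_
    calc F n (θ t w) ≤ F t w + F n (θ t w) := le_add_self
      _ = F (t + n) w := (hadd _ _ _ ht (by positivity)).symm
      _ ≤ _ := by
        refine hmono _ _ _ (by positivity) ?_
        push_cast; nlinarith [Nat.le_ceil t]
  -- the upper growth rate is at most `m`
  have hup : ∀ c : ℝ, m < ENNReal.ofReal c →
      μ {w | ∃ q : ℚ, c < q ∧ ∃ᶠ n : ℕ in atTop, q * n < G w n} = 0 := by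
    intro c hc
    have hc0 : 0 < c := ENNReal.ofReal_pos.1 (zero_le.trans_lt hc)
    refine (herg _ ?_ fun t ht => ?_).resolve_right fun hae => ?_
    · simp only [Set.ofPred_exists, Set.ofPred_and]
      exact MeasurableSet.iUnion fun q => (MeasurableSet.const _).inter
        (measurableSet_setOf_frequently_nat fun n => measurableSet_lt measurable_const (hGm n))
    · ext w
      exact ⟨frequently_mul_lt_of_le (hG2 t ht w), frequently_mul_lt_of_le (hG1 t ht w)⟩
    · refine hc.not_ge (le_lintegral_of_le_birkhoffSum hθ (hF 1) ENNReal.ofReal_ne_top ?_)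
      filter_upwards [hae] with w ⟨q, hcq, hq⟩
      obtain ⟨n, hn, hlt⟩ := frequently_atTop.1 hq 1
      refine ⟨n, hn, ?_⟩
      rw [← hbirk, ← hGF, ← ENNReal.ofReal_natCast, ← ENNReal.ofReal_mul (by positivity)]
      refine ENNReal.ofReal_le_ofReal ?_
      have : (0 : ℝ) < n := by exact_mod_cast hn
      nlinarith
  -- the lower growth rate is at least `m`
  have hlow : ∀ c : ℝ, ENNReal.ofReal c < m →
      μ {w | ∃ q : ℚ, (q : ℝ) < c ∧ ∃ᶠ n : ℕ in atTop, G w n < q * n} = 0 := by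
    intro c hc
    refine (herg _ ?_ fun t ht => ?_).resolve_right fun hae => ?_
    · simp only [Set.ofPred_exists, Set.ofPred_and]
      exact MeasurableSet.iUnion fun q => (MeasurableSet.const _).inter
        (measurableSet_setOf_frequently_nat fun n => measurableSet_lt (hGm n) measurable_const)
    · ext w
      exact ⟨frequently_lt_mul_of_le (hG1 t ht w), frequently_lt_mul_of_le (hG2 t ht w)⟩
    · refine hc.not_ge (lintegral_le_of_birkhoffSum_le hθ (hF 1) (hfin 1) ?_)
      filter_upwards [hae] with w ⟨q, hcq, hq⟩
      obtain ⟨n, hn, hlt⟩ := frequently_atTop.1 hq 1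
      refine ⟨n, hn, ?_⟩
      rw [← hbirk, ← hGF, ← ENNReal.ofReal_natCast, ← ENNReal.ofReal_mul (by positivity)]
      refine ENNReal.ofReal_le_ofReal ?_
      have : (0 : ℝ) < n := by exact_mod_cast hn
      nlinarith
  have hup' : ∀ᵐ w ∂μ, ∀ c : ℚ, m < ENNReal.ofReal c →
      ∀ q : ℚ, (c : ℝ) < q → ∀ᶠ n : ℕ in atTop, G w n ≤ q * n := by
    refine ae_all_iff.2 fun c => ?_
    by_cases hc : m < ENNReal.ofReal c
    · filter_upwards [measure_eq_zero_iff_ae_notMem.1 (hup c hc)] with w hw _ q hq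
      simp only [not_exists, not_and, not_frequently, not_lt] at hw
      exact hw q hq
    · exact ae_of_all _ fun _ h => absurd h hc
  have hlow' : ∀ᵐ w ∂μ, ∀ c : ℚ, ENNReal.ofReal c < m →
      ∀ q : ℚ, (q : ℝ) < c → ∀ᶠ n : ℕ in atTop, q * n ≤ G w n := by
    refine ae_all_iff.2 fun c => ?_
    by_cases hc : ENNReal.ofReal c < m
    · filter_upwards [measure_eq_zero_iff_ae_notMem.1 (hlow c hc)] with w hw _ q hq
      simp only [not_exists, not_and, not_frequently, not_lt] at hw
      exact hw q hq
    · exact ae_of_all _ fun _ h => absurd h hc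
  filter_upwards [hup', hlow'] with w hwu hwl
  refine tendsto_order.2 ⟨fun a ha => ?_, fun a ha => ?_⟩
  · obtain ⟨c, -, hac, hcm⟩ := ENNReal.lt_iff_exists_rat_btwn.1 ha
    obtain ⟨q, hq0, haq, hqc⟩ := ENNReal.lt_iff_exists_rat_btwn.1 hac
    obtain ⟨q', hq'0, haq', hqq'⟩ := ENNReal.lt_iff_exists_rat_btwn.1 haq
    have hlt : ∀ {x y : ℚ}, ENNReal.ofReal x < ENNReal.ofReal y → (x : ℝ) < y := fun h =>
      (ENNReal.ofReal_lt_ofReal_iff').1 h |>.1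
    have hev := hwl c hcm q (hlt hqc)
    obtain ⟨N, hN⟩ := exists_add_le_mul (hlt hqq') q
    filter_upwards [(tendsto_nat_floor_atTop (α := ℝ)).eventually hev,
      eventually_ge_atTop (N : ℝ), eventually_gt_atTop 0] with t h1 h2 h3
    refine haq'.trans_le ?_
    change ENNReal.ofReal q' ≤ _
    rw [ENNReal.le_div_iff_mul_le (by simp [h3]) (by simp),
      ← ENNReal.ofReal_mul (by exact_mod_cast hq'0)]
    refine le_trans ?_ (hmono w _ _ (Nat.cast_nonneg _) (Nat.floor_le h3.le))
    rw [← hGF]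
    refine ENNReal.ofReal_le_ofReal (le_trans ?_ h1)
    have h4 := hN t h2
    have h5 := Nat.lt_floor_add_one t
    have hq0' : (0 : ℝ) ≤ q := by exact_mod_cast hq0
    nlinarith
  · obtain ⟨c, -, hac, hcm⟩ := ENNReal.lt_iff_exists_rat_btwn.1 ha
    obtain ⟨q, hq0, haq, hqc⟩ := ENNReal.lt_iff_exists_rat_btwn.1 hcm
    obtain ⟨q', hq'0, haq', hqq'⟩ := ENNReal.lt_iff_exists_rat_btwn.1 hqc
    have hlt : ∀ {x y : ℚ}, ENNReal.ofReal x < ENNReal.ofReal y → (x : ℝ) < y := fun h =>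
      (ENNReal.ofReal_lt_ofReal_iff').1 h |>.1
    have hev := hwu c hac q (hlt haq)
    obtain ⟨N, hN⟩ := exists_add_le_mul (hlt haq') q
    have htend : Tendsto (fun t : ℝ => ⌊t⌋₊ + 1) atTop atTop :=
      (tendsto_add_atTop_nat 1).comp tendsto_nat_floor_atTop
    filter_upwards [htend.eventually hev,
      eventually_ge_atTop (N : ℝ), eventually_gt_atTop 0] with t h1 h2 h3
    refine lt_of_le_of_lt ?_ hqq'
    change _ ≤ ENNReal.ofReal q'
    rw [ENNReal.div_le_iff_le_mul (by simp [h3]) (by simp),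
      ← ENNReal.ofReal_mul (by exact_mod_cast hq'0)]
    refine le_trans (hmono w _ ((⌊t⌋₊ + 1 : ℕ) : ℝ) h3.le
      (by push_cast; exact (Nat.lt_floor_add_one t).le)) ?_
    rw [← hGF]
    refine ENNReal.ofReal_le_ofReal (h1.trans ?_)
    have h4 := hN t h2
    have h5 := Nat.floor_le h3.le
    have hq0' : (0 : ℝ) ≤ q := by exact_mod_cast hq0
    push_cast
    nlinarith

end Flow

/-! ### Trajectories: indices, shifts, measurability and predictability -/

section Countability

instance : DiscreteMeasurableSpace State := ⟨fun _ => trivial⟩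

instance (A : ℕ) : DiscreteMeasurableSpace (Event A) := ⟨fun _ => trivial⟩

instance : Countable State :=
  Function.Injective.countable (f := fun u : State => (u.bidQty, u.askQty, u.spread))
    fun u v h => by
      simp only [Prod.mk.injEq] at h
      exact State.ext h.1 h.2.1 h.2.2

instance : Finite Side :=
  Finite.of_injective (fun b : Side => decide (b = .bid)) fun a b => by
    cases a <;> cases b <;> simp

instance : Finite Direction :=
  Finite.of_injective (fun b : Direction => decide (b = .provide)) fun a b => by
    cases a <;> cases b <;> simp

instance (A : ℕ) : Countable (Event A) :=
  Function.Injective.countable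
    (f := fun e : Event A => (e.size, e.level, e.dir, e.side, e.redrawn, e.state, e.agent))
    fun e e' h => by
      simp only [Prod.mk.injEq] at h
      obtain ⟨h1, h2, h3, h4, h5, h6, h7⟩ := h
      exact Event.ext h1 h2 h3 h4 h5 h6 h7

end Countability

namespace Path

variable {A : ℕ}

lemma ext_of {w w' : Path A} (hT : w.T = w'.T) (hX : w.X = w'.X) : w = w' := by
  cases w; cases w'; simp_all

lemma idx_eq_iff (w : Path A) (t : ℝ) (j : ℤ) : w.idx t = j ↔ w.T j ≤ t ∧ t < w.T (j + 1) := by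
  refine ⟨fun h => h ▸ ⟨w.T_idx_le t, w.lt_T_idx_add_one t⟩, fun ⟨h1, h2⟩ => ?_⟩
  have h3 := w.strictMono.lt_iff_lt.1 ((w.T_idx_le t).trans_lt h2)
  have h4 := w.strictMono.lt_iff_lt.1 (h1.trans_lt (w.lt_T_idx_add_one t))
  omega

lemma leftIdx_nonempty (w : Path A) (t : ℝ) : {i : ℤ | w.T i < t}.Nonempty :=
  (w.tendsto_atBot.eventually (eventually_lt_atBot t)).exists

lemma leftIdx_bddAbove (w : Path A) (t : ℝ) : BddAbove {i : ℤ | w.T i < t} :=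
  (w.idx_bddAbove t).mono fun i (hi : w.T i < t) => hi.le

lemma T_leftIdx_lt (w : Path A) (t : ℝ) : w.T (w.leftIdx t) < t :=
  Int.csSup_mem (w.leftIdx_nonempty t) (w.leftIdx_bddAbove t)

lemma le_T_leftIdx_add_one (w : Path A) (t : ℝ) : t ≤ w.T (w.leftIdx t + 1) := by
  by_contra h
  have h1 : w.leftIdx t + 1 ≤ w.leftIdx t := le_csSup (w.leftIdx_bddAbove t) (not_le.mp h)
  omega

lemma leftIdx_eq_iff (w : Path A) (t : ℝ) (j : ℤ) :
    w.leftIdx t = j ↔ w.T j < t ∧ t ≤ w.T (j + 1) := by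
  refine ⟨fun h => h ▸ ⟨w.T_leftIdx_lt t, w.le_T_leftIdx_add_one t⟩, fun ⟨h1, h2⟩ => ?_⟩
  have h3 := w.strictMono.lt_iff_lt.1 ((w.T_leftIdx_lt t).trans_le h2)
  have h4 := w.strictMono.lt_iff_lt.1 (h1.trans_le (w.le_T_leftIdx_add_one t))
  omega

lemma leftIdx_T (w : Path A) (i : ℤ) : w.leftIdx (w.T i) = i - 1 :=
  (w.leftIdx_eq_iff _ _).2 ⟨w.strictMono (by omega), by simp⟩

lemma idx_zero (w : Path A) : w.idx 0 = 0 :=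
  (w.idx_eq_iff _ _).2 ⟨w.T_zero_le, by simpa using w.T_one_pos⟩

lemma leftIdx_eq_idx (w : Path A) {t : ℝ} (ht : t ∉ Set.range w.T) : w.leftIdx t = w.idx t :=
  (w.leftIdx_eq_iff _ _).2
    ⟨lt_of_le_of_ne (w.T_idx_le t) fun h => ht ⟨_, h⟩, (w.lt_T_idx_add_one t).le⟩

lemma tendsto_leftIdx (w : Path A) : Tendsto w.leftIdx atTop atTop := by
  refine Filter.tendsto_atTop.2 fun j => ?_
  filter_upwards [eventually_gt_atTop (w.T j)] with t ht
  exact le_csSup (w.leftIdx_bddAbove t) ht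

lemma shift_T (w : Path A) (t : ℝ) (i : ℤ) : (w.shift t).T i = w.T (i + w.idx t) - t := rfl

lemma shift_X (w : Path A) (t : ℝ) (i : ℤ) : (w.shift t).X i = w.X (i + w.idx t) := rfl

lemma idx_shift (w : Path A) (s t : ℝ) : (w.shift s).idx t = w.idx (s + t) - w.idx s := by
  rw [idx_eq_iff]
  have h1 := w.T_idx_le (s + t)
  have h2 := w.lt_T_idx_add_one (s + t)
  simp only [shift_T]
  rw [show w.idx (s + t) - w.idx s + w.idx s = w.idx (s + t) by ring,
    show w.idx (s + t) - w.idx s + 1 + w.idx s = w.idx (s + t) + 1 by ring]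
  constructor <;> linarith

lemma shift_neg_shift (w : Path A) (t : ℝ) : (w.shift t).shift (-t) = w := by
  have h : (w.shift t).idx (-t) = - w.idx t := by rw [idx_shift, add_neg_cancel, idx_zero]; ring
  refine ext_of (funext fun i => ?_) (funext fun i => ?_)
  · simp [shift_T, h]
  · simp [shift_X, h]

lemma history_shift (w : Path A) (t : ℝ) (i : ℤ) :
    (w.shift t).history i = w.history (i + w.idx t) := by
  funext k
  simp only [history, U, shift_X]
  congr 2; ring

lemma history_eq_prepend (w : Path A) (i : ℤ) :
    w.history i = prepend (w.X i).state (w.history (i - 1)) := by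
  funext k
  cases k with
  | zero => simp [history, prepend, U]
  | succ k => simp only [history, prepend, U]; congr 2; push_cast; ring

section Measurability

lemma measurable_idx : Measurable fun p : Path A × ℝ => p.1.idx p.2 := by
  refine measurable_to_countable' fun j => ?_
  have : (fun p : Path A × ℝ => p.1.idx p.2) ⁻¹' {j} =
      {p | p.1.T j ≤ p.2} ∩ {p | p.2 < p.1.T (j + 1)} := by
    ext p; exact idx_eq_iff _ _ _
  rw [this]
  exact (measurableSet_le ((measurable_T j).comp measurable_fst) measurable_snd).inter
    (measurableSet_lt measurable_snd ((measurable_T _).comp measurable_fst))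

lemma measurable_leftIdx : Measurable fun p : Path A × ℝ => p.1.leftIdx p.2 := by
  refine measurable_to_countable' fun j => ?_
  have : (fun p : Path A × ℝ => p.1.leftIdx p.2) ⁻¹' {j} =
      {p | p.1.T j < p.2} ∩ {p | p.2 ≤ p.1.T (j + 1)} := by
    ext p; exact leftIdx_eq_iff _ _ _
  rw [this]
  exact (measurableSet_lt ((measurable_T j).comp measurable_fst) measurable_snd).inter
    (measurableSet_le measurable_snd ((measurable_T _).comp measurable_fst))

lemma measurable_X_index : Measurable fun p : Path A × ℤ => p.1.X p.2 :=
  measurable_from_prod_countable_left fun i => measurable_X i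

lemma measurable_T_index : Measurable fun p : Path A × ℤ => p.1.T p.2 :=
  measurable_from_prod_countable_left fun i => measurable_T i

lemma measurable_U_index : Measurable fun p : Path A × ℤ => p.1.U p.2 :=
  (measurable_of_countable Event.state).comp measurable_X_index

lemma measurable_history_index : Measurable fun p : Path A × ℤ => p.1.history p.2 :=
  measurable_pi_lambda _ fun k => measurable_U_index.comp
    (measurable_fst.prodMk ((measurable_of_countable fun i : ℤ => i - k).comp measurable_snd))

lemma measurable_mk {Ω : Type*} {m : MeasurableSpace Ω} {g : Ω → Path A}
    (hT : ∀ i, Measurable fun x => (g x).T i) (hX : ∀ i, Measurable fun x => (g x).X i) :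
    Measurable g :=
  measurable_comap_iff.2 ((measurable_pi_lambda _ hT).prodMk (measurable_pi_lambda _ hX))

lemma measurable_shift (t : ℝ) : Measurable fun w : Path A => w.shift t := by
  have h : ∀ i : ℤ, Measurable fun w : Path A => (w, i + w.idx t) := fun i =>
    measurable_id.prodMk ((measurable_of_countable fun j : ℤ => i + j).comp
      (measurable_idx.comp (measurable_id.prodMk measurable_const)))
  exact measurable_mk (fun i => (measurable_T_index.comp (h i)).sub_const t)
    fun i => measurable_X_index.comp (h i)

end Measurability

section Filtration

lemma measurableSet_filtration {t : ℝ≥0} (n : ℤ) {C : Set ℝ} (hC : MeasurableSet C)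
    (hCt : C ⊆ Set.Iic (t : ℝ)) (B : Set (Event A)) :
    MeasurableSet[filtration A t] {w | w.T n ∈ C ∧ w.X n ∈ B} :=
  MeasurableSpace.measurableSet_generateFrom ⟨n, C, B, hC, hCt, trivial, rfl⟩

/-- The history of the market at large times exhausts all events. -/
lemma le_iSup_filtration :
    (inferInstance : MeasurableSpace (Path A)) ≤ ⨆ n : ℕ, filtration A (n : ℝ≥0) := by
  have key : ∀ (i : ℤ) (C : Set ℝ) (B : Set (Event A)), MeasurableSet C →
      MeasurableSet[⨆ n : ℕ, filtration A (n : ℝ≥0)] {w : Path A | w.T i ∈ C ∧ w.X i ∈ B} := by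
    intro i C B hC
    have : {w : Path A | w.T i ∈ C ∧ w.X i ∈ B} =
        ⋃ n : ℕ, {w | w.T i ∈ C ∩ Set.Iic (n : ℝ) ∧ w.X i ∈ B} := by
      ext w
      simp only [Set.mem_ofPred_eq, Set.mem_iUnion, Set.mem_inter_iff, Set.mem_Iic]
      obtain ⟨n, hn⟩ := exists_nat_ge (w.T i)
      exact ⟨fun h => ⟨n, ⟨h.1, hn⟩, h.2⟩, fun ⟨_, h, h'⟩ => ⟨h.1, h'⟩⟩
    rw [this]
    refine MeasurableSet.iUnion fun n => ?_
    exact le_iSup (fun n : ℕ => (filtration A (n : ℝ≥0) : MeasurableSpace (Path A))) n _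
      (measurableSet_filtration i (hC.inter measurableSet_Iic) (by
        intro x hx; simpa using hx.2) B)
  have hmeas : @Measurable (Path A) (Path A) (⨆ n : ℕ, filtration A (n : ℝ≥0))
      inferInstance id := by
    refine @measurable_mk A _ (⨆ n : ℕ, filtration A (n : ℝ≥0)) id (fun i C hC => ?_)
      fun i B _ => ?_
    · convert! key i C Set.univ hC using 1
      ext; simp
    · convert! key i Set.univ B MeasurableSet.univ using 1
      ext; simp
  intro s hs
  exact hmeas hs

/-- The past at time `r` of the trajectory seen from time `-r` is the past at time `0`. -/
lemma measurable_shift_neg_filtration (r : ℝ≥0) :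
    Measurable[filtration A 0, filtration A r] fun w : Path A => w.shift (-r) := by
  refine @measurable_generateFrom _ _ (filtration A 0) _ _ ?_
  rintro _ ⟨n, C, B, hC, hCr, -, rfl⟩
  have : (fun w : Path A => w.shift (-r)) ⁻¹' {w | w.T n ∈ C ∧ w.X n ∈ B} =
      ⋃ k : ℤ, ({w | w.T k ∈ Set.Iic (-r : ℝ) ∧ w.X k ∈ Set.univ} ∩
        {w | w.T (k + 1) ∈ Set.Iic (-r : ℝ) ∧ w.X (k + 1) ∈ Set.univ}ᶜ) ∩
        {w | w.T (n + k) ∈ (fun x => x + (r : ℝ)) ⁻¹' C ∧ w.X (n + k) ∈ B} := by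
    ext w
    simp only [Set.mem_preimage, Set.mem_ofPred_eq, Set.mem_iUnion, Set.mem_inter_iff, Set.mem_Iic,
      Set.mem_univ, and_true, Set.mem_compl_iff, not_le, ← idx_eq_iff, shift_T, shift_X,
      sub_neg_eq_add]
    exact ⟨fun h => ⟨_, rfl, h⟩, fun ⟨k, hk, h⟩ => hk ▸ h⟩
  rw [this]
  have hr : Set.Iic (-r : ℝ) ⊆ Set.Iic ((0 : ℝ≥0) : ℝ) := by
    intro x hx
    have := r.2
    simp only [Set.mem_Iic, NNReal.coe_zero] at hx ⊢
    linarith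
  refine MeasurableSet.iUnion fun k => ((measurableSet_filtration k measurableSet_Iic hr _).inter
    (measurableSet_filtration (k + 1) measurableSet_Iic hr _).compl).inter
    (measurableSet_filtration _ (measurable_add_const _ hC) ?_ _)
  intro x hx
  have : x + r ≤ (r : ℝ) := hCr hx
  simpa using this

/-- That the `j`-th event has its mark in `B` and happened strictly before the current time is
predictable: a rational time separates it from the current time, unless this is `0`. -/
lemma measurableSet_predictable_T_lt (j : ℤ) (B : Set (Event A)) :
    MeasurableSet[(filtration A).predictable]
      {p : ℝ≥0 × Path A | p.2.T j < p.1 ∧ p.2.X j ∈ B} := by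
  have : {p : ℝ≥0 × Path A | p.2.T j < p.1 ∧ p.2.X j ∈ B} =
      ({⊥} ×ˢ {w | w.T j ∈ Set.Iio 0 ∧ w.X j ∈ B}) ∪
        ⋃ q : ℚ, Set.Ioi (q : ℝ).toNNReal ×ˢ
          {w | w.T j ∈ Set.Iic ((q : ℝ).toNNReal : ℝ) ∧ w.X j ∈ B} := by
    ext ⟨s, w⟩
    simp only [Set.mem_ofPred_eq, Set.mem_union, Set.mem_prod, Set.mem_singleton_iff, Set.mem_Iio,
      Set.mem_iUnion, Set.mem_Ioi, Set.mem_Iic]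
    constructor
    · rintro ⟨h1, h2⟩
      rcases eq_or_lt_of_le (zero_le : 0 ≤ s) with rfl | hs
      · exact Or.inl ⟨rfl, by simpa using h1, h2⟩
      · right
        obtain ⟨q, hq1, hq2⟩ := exists_rat_btwn (max_lt h1 (by exact_mod_cast hs : (0:ℝ) < s))
        have hq0 : (0 : ℝ) ≤ q := (le_max_right _ _).trans hq1.le
        refine ⟨q, ?_, ?_, h2⟩
        · rwa [← NNReal.coe_lt_coe, Real.coe_toNNReal _ hq0]
        · rw [Real.coe_toNNReal _ hq0]
          exact (le_max_left _ _).trans hq1.le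
    · rintro (⟨rfl, h1, h2⟩ | ⟨q, h1, h2, h3⟩)
      · exact ⟨by simpa using h1, h2⟩
      · exact ⟨h2.trans_lt (by exact_mod_cast h1), h3⟩
  rw [this]
  refine MeasurableSet.union (measurableSet_predictable_singleton_bot_prod
    (measurableSet_filtration _ measurableSet_Iio ?_ _)) (MeasurableSet.iUnion fun q =>
    measurableSet_predictable_Ioi_prod (measurableSet_filtration _ measurableSet_Iic le_rfl _))
  intro x hx
  exact le_trans (le_of_lt hx) (NNReal.coe_nonneg _)

/-- The sequence of the states of the book strictly before the current time is predictable. -/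
lemma measurable_predictable_history :
    Measurable[(filtration A).predictable]
      fun p : ℝ≥0 × Path A => p.2.history (p.2.leftIdx p.1) := by
  refine @measurable_pi_lambda _ _ _ (filtration A).predictable _ _ fun k => ?_
  refine @measurable_to_countable' _ _ _ _ (filtration A).predictable _ fun u => ?_
  have : (fun p : ℝ≥0 × Path A => p.2.history (p.2.leftIdx p.1) k) ⁻¹' {u} =
      ⋃ j : ℤ, ({p | p.2.T j < p.1 ∧ p.2.X j ∈ Set.univ} ∩
        {p | p.2.T (j + 1) < p.1 ∧ p.2.X (j + 1) ∈ Set.univ}ᶜ) ∩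
        {p | p.2.T (j - k) < p.1 ∧ p.2.X (j - k) ∈ {e | e.state = u}} := by
    ext ⟨s, w⟩
    simp only [Set.mem_preimage, Set.mem_singleton_iff, Set.mem_iUnion, Set.mem_inter_iff,
      Set.mem_ofPred_eq, Set.mem_univ, and_true, Set.mem_compl_iff, not_lt, ← leftIdx_eq_iff]
    constructor
    · intro h
      exact ⟨_, rfl, (w.strictMono.monotone (by omega)).trans_lt (w.T_leftIdx_lt s), h⟩
    · rintro ⟨j, rfl, -, h⟩
      exact h
  rw [this]
  exact MeasurableSet.iUnion fun j => ((measurableSet_predictable_T_lt _ _).inter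
    (measurableSet_predictable_T_lt _ _).compl).inter (measurableSet_predictable_T_lt _ _)

end Filtration

end Path

/-! ### Joint measurability of the intensity -/

section Intensity

variable {A : ℕ} {ψ : Event A → State → ℝ → ℝ≥0 → ℝ≥0} {φ : Event A → State → ℝ → Event A → ℝ≥0}

/-- The arrival rate is jointly measurable in the trajectory and time. The parameters are measurable
in their real arguments only, which is enough as states and events form countable sets. -/
lemma measurable_intensity (hψ : ∀ e u, Measurable (Function.uncurry (ψ e u)))
    (hφ : ∀ e u x, Measurable (fun s => φ e u s x)) (e : Event A) :
    Measurable fun p : Path A × ℝ => intensity ψ φ p.1 p.2 e := by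
  classical
  have hterm : ∀ (u : State) (i : ℤ), Measurable fun p : Path A × ℝ =>
      if p.1.T i < p.2 then φ e u (p.2 - p.1.T i) (p.1.X i) else 0 := by
    intro u i
    have hT : Measurable fun p : Path A × ℝ => p.1.T i := (Path.measurable_T i).comp measurable_fst
    have hφ' : Measurable fun q : ℝ × Event A => φ e u q.1 q.2 :=
      measurable_from_prod_countable_left fun x => hφ e u x
    exact Measurable.ite (measurableSet_lt hT measurable_snd)
      (hφ'.comp ((measurable_snd.sub hT).prodMk ((Path.measurable_X i).comp measurable_fst)))
      measurable_const
  have hG : Measurable fun q : State × (Path A × ℝ) => ψ e q.1 q.2.2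
      (∑' i : ℤ, if q.2.1.T i < q.2.2 then φ e q.1 (q.2.2 - q.2.1.T i) (q.2.1.X i) else 0) :=
    measurable_from_prod_countable_right fun u =>
      (hψ e u).comp (measurable_snd.prodMk (Measurable.tsum (hterm u)))
  have hu : Measurable fun p : Path A × ℝ => p.1.U (p.1.leftIdx p.2) :=
    Path.measurable_U_index.comp (measurable_fst.prodMk Path.measurable_leftIdx)
  exact hG.comp (hu.prodMk measurable_id)

end Intensity

/-! ### Ergodicity of the unique invariant law -/

section Ergodicity

variable {A : ℕ} {ψ : Event A → State → ℝ → ℝ≥0 → ℝ≥0} {φ : Event A → State → ℝ → Event A → ℝ≥0}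
  {P : Measure (Path A)}

lemma IsInvariantLaw.measurePreserving_shift (hP : IsInvariantLaw ψ φ P) {t : ℝ} (ht : 0 ≤ t) :
    MeasurePreserving (fun w : Path A => w.shift t) P P := by
  refine ⟨Path.measurable_shift t, ?_⟩
  have := ((hP.invariant t ht).comp measurable_fst).map_eq
  simpa [Function.comp_def] using this

/-- A shift invariant event belongs to the past at time `0`, up to a null event: it is approximated
by events of the past at time `n`, and moving these back by `n` keeps the approximation. -/
lemma exists_measurableSet_filtration_ae_eq [IsProbabilityMeasure P] (hP : IsInvariantLaw ψ φ P)
    {B : Set (Path A)} (hB : MeasurableSet B)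
    (hinv : ∀ t : ℝ, 0 ≤ t → (fun w : Path A => w.shift t) ⁻¹' B = B) :
    ∃ B₀, MeasurableSet[Path.filtration A 0] B₀ ∧ B₀ =ᵐ[P] B := by
  set ℱ : Filtration ℕ (inferInstance : MeasurableSpace (Path A)) :=
    { seq := fun n => Path.filtration A n
      mono' := fun i j hij => (Path.filtration A).mono (by exact_mod_cast hij)
      le' := fun n => (Path.filtration A).le _ } with hℱ
  set g : Path A → ℝ := B.indicator fun _ => 1 with hg
  have hgm : Measurable g := measurable_const.indicator hB
  have hgi : Integrable g P := (integrable_const 1).indicator hB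
  have hlim : Tendsto (fun n => eLpNorm (P[g | ℱ n] - g) 1 P) atTop (𝓝 0) := by
    refine hgi.tendsto_eLpNorm_condExp (Measurable.stronglyMeasurable ?_)
    exact hgm.mono Path.le_iSup_filtration le_rfl
  set k : ℕ → Path A → ℝ := fun n w => P[g | ℱ n] (w.shift (-n)) with hk
  have hkm : ∀ n, StronglyMeasurable[Path.filtration A 0] (k n) := fun n => by
    have h1 : Measurable[Path.filtration A n] (P[g | ℱ n]) :=
      (stronglyMeasurable_condExp (m := ℱ n)).measurable
    exact (h1.comp (by
      simpa using Path.measurable_shift_neg_filtration (n : ℝ≥0))).stronglyMeasurable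
  have hle := (Path.filtration A).le 0
  -- `k n` is known at time `0` and as close to `g` as `P[g | ℱ n]` is, by stationarity
  have hkg : ∀ n, eLpNorm (k n - g) 1 P = eLpNorm (P[g | ℱ n] - g) 1 P := fun n => by
    rw [← eLpNorm_comp_measurePreserving
      (((hkm n).mono hle).sub hgm.stronglyMeasurable).aestronglyMeasurable
      (hP.measurePreserving_shift (Nat.cast_nonneg n))]
    congr 1
    funext w
    have : g (w.shift n) = g w := by
      have : w.shift n ∈ B ↔ w ∈ B := by
        conv_rhs => rw [← hinv n (Nat.cast_nonneg n)]
        rfl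
      by_cases hw : w ∈ B
      · rw [hg, Set.indicator_of_mem (this.2 hw), Set.indicator_of_mem hw]
      · rw [hg, Set.indicator_of_notMem (mt this.1 hw), Set.indicator_of_notMem hw]
    simp [hk, Path.shift_neg_shift, this]
  have hki : ∀ n, Integrable (k n) P := fun n => by
    refine (memLp_one_iff_integrable.1 ?_)
    have h2 : MemLp (k n - g) 1 P := by
      refine ⟨(((hkm n).mono hle).sub hgm.stronglyMeasurable).aestronglyMeasurable, ?_⟩
      rw [hkg]
      exact (memLp_one_iff_integrable.2 (integrable_condExp.sub hgi)).2
    simpa using h2.add (memLp_one_iff_integrable.2 hgi)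
  have hbound : ∀ n, eLpNorm (P[g | Path.filtration A 0] - g) 1 P ≤
      eLpNorm (P[g | ℱ n] - g) 1 P + eLpNorm (P[g | ℱ n] - g) 1 P := fun n => by
    have h3 : P[g | Path.filtration A 0] - g =ᵐ[P]
        P[g - k n | Path.filtration A 0] + (k n - g) := by
      have h4 := condExp_sub hgi (hki n) (Path.filtration A 0)
      have h5 := condExp_of_stronglyMeasurable hle (hkm n) (hki n)
      filter_upwards [h4] with w hw
      simp [hw, h5]
    rw [eLpNorm_congr_ae h3]
    refine (eLpNorm_add_le ?_ ?_ le_rfl).trans (add_le_add ?_ ?_)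
    · exact (stronglyMeasurable_condExp.mono hle).aestronglyMeasurable
    · exact (((hkm n).mono hle).sub hgm.stronglyMeasurable).aestronglyMeasurable
    · rw [← hkg, eLpNorm_sub_comm]
      exact eLpNorm_condExp_le_eLpNorm _ le_rfl
    · rw [hkg]
  have hzero : eLpNorm (P[g | Path.filtration A 0] - g) 1 P = 0 := by
    have h2 := hlim.add hlim
    rw [add_zero] at h2
    exact le_antisymm (ge_of_tendsto' h2 hbound) zero_le
  rw [eLpNorm_eq_zero_iff ((stronglyMeasurable_condExp.mono hle).sub
    hgm.stronglyMeasurable).aestronglyMeasurable one_ne_zero] at hzero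
  refine ⟨P[g | Path.filtration A 0] ⁻¹' {1},
    stronglyMeasurable_condExp.measurable (measurableSet_singleton 1), ?_⟩
  rw [eventuallyEq_set]
  filter_upwards [hzero] with w hw
  have hw' : P[g | Path.filtration A 0] w = g w := by simpa [sub_eq_zero] using hw
  rw [Set.mem_preimage, hw', Set.mem_singleton_iff]
  by_cases hwB : w ∈ B
  · simp only [hg, Set.indicator_of_mem hwB, hwB]
  · simp only [hg, Set.indicator_of_notMem hwB, hwB, zero_ne_one]

/-- Conditioning an invariant law on a shift invariant event gives an invariant law. The intensity
is kept because the event belongs to the past at time `0`, so that its indicator is predictable. -/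
lemma IsInvariantLaw.cond [IsProbabilityMeasure P] (hP : IsInvariantLaw ψ φ P)
    {B : Set (Path A)} (hB : MeasurableSet B)
    (hinv : ∀ t : ℝ, 0 ≤ t → (fun w : Path A => w.shift t) ⁻¹' B = B) :
    IsInvariantLaw ψ φ P[|B] where
  follows := cond_absolutelyContinuous.ae_le hP.follows
  summable t ht := cond_absolutelyContinuous.ae_le (hP.summable t ht)
  hasIntensity := by
    intro e C hC
    obtain ⟨B₀, hB₀, hae⟩ := exists_measurableSet_filtration_ae_eq hP hB hinv
    have hB₀' : MeasurableSet B₀ := (Path.filtration A).le 0 _ hB₀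
    set C' : ℝ≥0 → Path A → ℝ≥0∞ := fun s => B₀.indicator (C s) with hC'
    have hpred : Measurable[(Path.filtration A).predictable] (Function.uncurry C') := by
      have h1 : Function.uncurry C' = (Set.univ ×ˢ B₀ : Set (ℝ≥0 × Path A)).indicator
          (Function.uncurry C) := by
        funext ⟨s, w⟩
        by_cases hw : w ∈ B₀ <;> simp [hC', hw, Function.uncurry]
      rw [h1]
      refine hC.indicator ?_
      have h2 : (Set.univ ×ˢ B₀ : Set (ℝ≥0 × Path A)) = ({⊥} ×ˢ B₀) ∪ (Set.Ioi 0 ×ˢ B₀) := by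
        rw [← Set.union_prod]
        congr 1
        ext s
        simp
      rw [h2]
      exact (measurableSet_predictable_singleton_bot_prod hB₀).union
        (measurableSet_predictable_Ioi_prod hB₀)
    have h := hP.hasIntensity e C' hpred
    have hred : ∀ G G' : Path A → ℝ≥0∞, (∀ w, G' w = B₀.indicator G w) →
        ∫⁻ w, G w ∂P[|B] = (P B)⁻¹ * ∫⁻ w, G' w ∂P := fun G G' hG => by
      rw [ProbabilityTheory.cond, lintegral_smul_measure, ← Measure.restrict_congr_set hae,
        ← lintegral_indicator hB₀', lintegral_congr hG, smul_eq_mul]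
    rw [hred _ _ fun w => ?_, h, ← hred _ _ fun w => ?_]
    all_goals by_cases hw : w ∈ B₀ <;> simp [hC', hw]
  invariant t ht := by
    have h := hP.invariant t ht
    refine ⟨h.aemeasurable_fst.mono_ac cond_absolutelyContinuous,
      h.aemeasurable_snd.mono_ac cond_absolutelyContinuous, Measure.ext fun S hS => ?_⟩
    rw [Measure.map_apply_of_aemeasurable (h.aemeasurable_fst.mono_ac cond_absolutelyContinuous) hS,
      Measure.map_apply_of_aemeasurable (h.aemeasurable_snd.mono_ac cond_absolutelyContinuous) hS,
      cond_apply hB, cond_apply hB]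
    congr 1
    -- `B` is read on the shifted trajectory, so that stationarity applies to `(B ×ˢ univ) ∩ S`
    have h1 := h.measure_mem_eq ((hB.prod MeasurableSet.univ).inter hS)
    convert! h1 using 2
    nth_rewrite 1 [← hinv t ht]
    ext w
    simp
    ext w
    simp

/-- If the invariant law is unique, it is ergodic. -/
lemma IsInvariantLaw.eq_zero_or_ae_mem [IsProbabilityMeasure P] (hP : IsInvariantLaw ψ φ P)
    (hunique : ∀ P' : Measure (Path A), IsProbabilityMeasure P' → IsInvariantLaw ψ φ P' → P' = P)
    {B : Set (Path A)} (hB : MeasurableSet B)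
    (hinv : ∀ t : ℝ, 0 ≤ t → (fun w : Path A => w.shift t) ⁻¹' B = B) :
    P B = 0 ∨ ∀ᵐ w ∂P, w ∈ B := by
  by_cases h0 : P B = 0
  · exact Or.inl h0
  · right
    have h := hunique _ (cond_isProbabilityMeasure h0) (hP.cond hB hinv)
    rw [← h]
    exact ae_cond_mem hB

end Ergodicity

/-! ### Transitions and time spent as additive functionals -/

section Observed

variable {A : ℕ} {Z : Type*} (f : (ℕ → State) → Z)

lemma zetaAt_shift (w : Path A) (t : ℝ) (i : ℤ) :
    zetaAt f (w.shift t) i = zetaAt f w (i + w.idx t) := by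
  simp only [zetaAt, Path.history_shift]

lemma zeta_shift (w : Path A) (s t : ℝ) : zeta f (w.shift s) t = zeta f w (s + t) := by
  simp only [zeta, zetaAt_shift, Path.idx_shift, sub_add_cancel]

open Classical in
/-- The number of the transitions from `z` to `z'` in `(0, t]`. -/
noncomputable def jumpCount (z z' : Z) (t : ℝ) (w : Path A) : ℝ≥0∞ :=
  ∑' i : ℤ, if (0 < w.T i ∧ w.T i ≤ t) ∧ zetaAt f w (i - 1) = z ∧ zetaAt f w i = z' then 1 else 0

open Classical in
/-- The time spent in `z` during `(0, t]`. -/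
noncomputable def occupation (z : Z) (t : ℝ) (w : Path A) : ℝ≥0∞ :=
  ∫⁻ s in Set.Ioc 0 t, if zeta f w s = z then 1 else 0

lemma Path.T_pos_iff (w : Path A) (i : ℤ) : 0 < w.T i ↔ 1 ≤ i := by
  constructor
  · intro h
    have := w.strictMono.lt_iff_lt.1 (w.T_zero_le.trans_lt h)
    omega
  · intro h
    exact w.T_one_pos.trans_le (w.strictMono.monotone h)

lemma Path.T_le_iff (w : Path A) (i : ℤ) (t : ℝ) : w.T i ≤ t ↔ i ≤ w.idx t := by
  constructor
  · intro h
    exact le_csSup (w.idx_bddAbove t) h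
  · intro h
    exact (w.strictMono.monotone h).trans (w.T_idx_le t)

lemma Path.T_lt_iff (w : Path A) (i : ℤ) (t : ℝ) : w.T i < t ↔ i ≤ w.leftIdx t := by
  constructor
  · intro h
    exact le_csSup (w.leftIdx_bddAbove t) h
  · intro h
    exact (w.strictMono.monotone h).trans_lt (w.T_leftIdx_lt t)

lemma Path.idx_T (w : Path A) (i : ℤ) : w.idx (w.T i) = i :=
  (w.idx_eq_iff _ _).2 ⟨le_rfl, w.strictMono (by omega)⟩

open Classical in
lemma jumpCount_eq_sum (z z' : Z) (t : ℝ) (w : Path A) :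
    jumpCount f z z' t w = ∑ i ∈ Finset.Icc 1 (w.idx t),
      if zetaAt f w (i - 1) = z ∧ zetaAt f w i = z' then 1 else 0 := by
  rw [jumpCount, tsum_eq_sum (s := Finset.Icc 1 (w.idx t))]
  · refine Finset.sum_congr rfl fun i hi => ?_
    rw [Finset.mem_Icc, ← w.T_pos_iff, ← w.T_le_iff] at hi
    simp [hi]
  · intro i hi
    rw [Finset.mem_Icc, ← w.T_pos_iff, ← w.T_le_iff] at hi
    rw [if_neg fun h => hi h.1]

lemma jumpCount_ne_top (z z' : Z) (t : ℝ) (w : Path A) : jumpCount f z z' t w ≠ ⊤ := by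
  classical
  rw [jumpCount_eq_sum]
  exact ENNReal.sum_ne_top.2 fun i _ => by split_ifs <;> simp

lemma jumpCount_zero (z z' : Z) (w : Path A) : jumpCount f z z' 0 w = 0 := by
  rw [jumpCount_eq_sum, Path.idx_zero]; simp

lemma jumpCount_add (z z' : Z) {s t : ℝ} (hs : 0 ≤ s) (ht : 0 ≤ t) (w : Path A) :
    jumpCount f z z' (s + t) w = jumpCount f z z' s w + jumpCount f z z' t (w.shift s) := by
  classical
  have h : jumpCount f z z' t (w.shift s) = ∑' i : ℤ,
      if (s < w.T i ∧ w.T i ≤ s + t) ∧ zetaAt f w (i - 1) = z ∧ zetaAt f w i = z'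
        then 1 else 0 := by
    rw [jumpCount, ← (Equiv.addRight (w.idx s)).tsum_eq fun i =>
      if (s < w.T i ∧ w.T i ≤ s + t) ∧ zetaAt f w (i - 1) = z ∧ zetaAt f w i = z' then
        (1 : ℝ≥0∞) else 0]
    refine tsum_congr fun i => ?_
    simp only [zetaAt_shift, Path.shift_T, Equiv.coe_addRight, sub_pos, sub_le_iff_le_add',
      sub_add_eq_add_sub]
    exact if_congr Iff.rfl rfl rfl
  rw [h, jumpCount, jumpCount, ← ENNReal.tsum_add]
  refine tsum_congr fun i => ?_
  by_cases hj : zetaAt f w (i - 1) = z ∧ zetaAt f w i = z'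
  · simp only [hj, and_self, and_true]
    by_cases h1 : w.T i ≤ s
    · simp [h1, h1.not_gt, h1.trans (le_add_of_nonneg_right ht)]
    · simp [h1, not_le.1 h1, hs.trans_lt (not_le.1 h1)]
  · simp [hj]

lemma occupation_ne_top (z : Z) (t : ℝ) (w : Path A) : occupation f z t w ≠ ⊤ := by
  classical
  refine ne_top_of_le_ne_top (b := ∫⁻ _ in Set.Ioc 0 t, 1) (by simp) ?_
  exact lintegral_mono fun s => by dsimp only; split_ifs <;> simp

lemma occupation_zero (z : Z) (w : Path A) : occupation f z 0 w = 0 := by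
  simp [occupation]

lemma occupation_add (z : Z) {s t : ℝ} (hs : 0 ≤ s) (ht : 0 ≤ t) (w : Path A) :
    occupation f z (s + t) w = occupation f z s w + occupation f z t (w.shift s) := by
  classical
  have h : occupation f z t (w.shift s) =
      ∫⁻ r in Set.Ioc s (s + t), if zeta f w r = z then 1 else 0 := by
    have hmp := (measurePreserving_add_left (volume : Measure ℝ) s).setLIntegral_comp_preimage_emb
      (measurableEmbedding_addLeft s) (fun r => if zeta f w r = z then (1 : ℝ≥0∞) else 0)
      (Set.Ioc s (s + t))
    rw [← hmp]
    simp [occupation, zeta_shift]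
  rw [h, occupation, occupation, ← Set.Ioc_union_Ioc_eq_Ioc hs (le_add_of_nonneg_right ht)]
  exact lintegral_union measurableSet_Ioc (Set.Ioc_disjoint_Ioc_of_le le_rfl)

open Classical in
lemma lintegral_zeta_Ioc (z : Z) (w : Path A) {i : ℤ} {a : ℝ} (hi : w.T i ≤ a) :
    ∫⁻ s in Set.Ioc a (w.T (i + 1)), (if zeta f w s = z then 1 else 0) =
      if zetaAt f w i = z then ENNReal.ofReal (w.T (i + 1) - a) else 0 := by
  rw [setLIntegral_congr Ioo_ae_eq_Ioc.symm,
    setLIntegral_congr_fun (g := fun _ => if zetaAt f w i = z then 1 else 0) measurableSet_Ioo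
      fun s hs => ?_]
  · rw [setLIntegral_const]
    split_ifs <;> simp
  · have : w.idx s = i := (w.idx_eq_iff _ _).2 ⟨hi.trans hs.1.le, hs.2⟩
    simp only [zeta, this]

open Classical in
/-- The last event strictly before `t` is the last one counted, so the transitions in `(0, t)` are
those in `(0, T_i]` with `i = leftIdx t`. -/
lemma transitions_eq_jumpCount (z z' : Z) (w : Path A) (t : ℝ) :
    ENNReal.ofReal (transitions f z z' w t) = jumpCount f z z' (w.T (w.leftIdx t)) w := by
  rw [jumpCount_eq_sum, Path.idx_T, transitions,
    finsum_cond_eq_sum_of_cond_iff (t := Finset.Icc 1 (w.leftIdx t)) _ fun {i} _ => by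
      rw [Finset.mem_Icc, w.T_lt_iff],
    ENNReal.ofReal_sum_of_nonneg fun i _ => by split_ifs <;> simp]
  refine Finset.sum_congr rfl fun i _ => ?_
  split_ifs <;> simp

open Classical in
/-- The holding intervals in `z` cover the time spent in `z` up to the last event and the part
before time `0` of the holding interval that contains `0`. -/
lemma timeSpent_eq_occupation (z : Z) (w : Path A) {t : ℝ} (ht : 1 ≤ w.leftIdx t) :
    ENNReal.ofReal (timeSpent f z w t) = occupation f z (w.T (w.leftIdx t)) w +
      if zetaAt f w 0 = z then ENNReal.ofReal (- w.T 0) else 0 := by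
  have hnn : ∀ i : ℤ, 0 ≤ w.T i - w.T (i - 1) := fun i =>
    sub_nonneg.2 (w.strictMono.monotone (by omega))
  rw [timeSpent,
    finsum_cond_eq_sum_of_cond_iff (t := Finset.Icc 1 (w.leftIdx t)) _ fun {i} _ => by
      rw [Finset.mem_Icc, w.T_lt_iff],
    ENNReal.ofReal_sum_of_nonneg fun i _ => by split_ifs <;> simp [-sub_nonneg, hnn]]
  generalize w.leftIdx t = m at ht
  induction m, ht using Int.leInduction with
  | base =>
    have h := lintegral_zeta_Ioc f z w w.T_zero_le
    rw [zero_add] at h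
    rw [occupation, h]
    simp only [Finset.Icc_self, Finset.sum_singleton, sub_self]
    split_ifs
    · rw [← ENNReal.ofReal_add (by simpa using w.T_one_pos.le) (by simpa using w.T_zero_le)]
      congr 1; ring
    · simp
  | succ m hm ih =>
    have hI : Finset.Icc 1 (m + 1) = insert (m + 1) (Finset.Icc 1 m) := by
      ext i; simp only [Finset.mem_Icc, Finset.mem_insert]; omega
    have h := lintegral_zeta_Ioc f z w (le_refl (w.T m))
    have hpos := (w.T_pos_iff m).2 hm
    rw [hI, Finset.sum_insert (by simp), ih, occupation, occupation,
      ← Set.Ioc_union_Ioc_eq_Ioc hpos.le (w.strictMono.monotone (by omega : m ≤ m + 1)),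
      lintegral_union measurableSet_Ioc (Set.Ioc_disjoint_Ioc_of_le le_rfl), h]
    simp only [add_sub_cancel_right]
    rw [add_right_comm, add_comm]
    congr 1
    split_ifs <;> simp

section Measurability

variable [MeasurableSpace Z] {f}

lemma measurable_zetaAt (hf : Measurable f) (i : ℤ) : Measurable fun w : Path A => zetaAt f w i :=
  hf.comp (Path.measurable_history_index.comp (measurable_id.prodMk measurable_const))

lemma measurable_zeta (hf : Measurable f) : Measurable fun p : Path A × ℝ => zeta f p.1 p.2 :=
  hf.comp (Path.measurable_history_index.comp (measurable_fst.prodMk Path.measurable_idx))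

variable [MeasurableSingletonClass Z]

lemma measurable_jumpCount (hf : Measurable f) (z z' : Z) (t : ℝ) :
    Measurable (jumpCount f z z' t : Path A → ℝ≥0∞) := by
  classical
  refine Measurable.tsum fun i => Measurable.ite ?_ measurable_const measurable_const
  exact ((measurableSet_lt measurable_const (Path.measurable_T i)).inter
    (measurableSet_le (Path.measurable_T i) measurable_const)).inter
    ((measurable_zetaAt hf _ (measurableSet_singleton z)).inter
      (measurable_zetaAt hf _ (measurableSet_singleton z')))

lemma measurable_zeta_indicator (hf : Measurable f) (z : Z) [∀ x : Z, Decidable (x = z)] :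
    Measurable fun p : Path A × ℝ => if zeta f p.1 p.2 = z then (1 : ℝ≥0∞) else 0 :=
  Measurable.ite (measurable_zeta hf (measurableSet_singleton z)) measurable_const measurable_const

lemma measurable_occupation (hf : Measurable f) (z : Z) (t : ℝ) :
    Measurable (occupation f z t : Path A → ℝ≥0∞) := by
  classical
  exact (measurable_zeta_indicator hf z).lintegral_prod_right'

lemma measurable_prepend (u : State) : Measurable (prepend u) :=
  measurable_pi_lambda _ fun k => by
    cases k with
    | zero => exact measurable_const
    | succ k => exact measurable_pi_apply k

end Measurability

end Observed

/-! ### Means of the functionals -/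

section Mean

variable {A : ℕ} {ψ : Event A → State → ℝ → ℝ≥0 → ℝ≥0} {φ : Event A → State → ℝ → Event A → ℝ≥0}
  {P : Measure (Path A)} {Z : Type*} [MeasurableSpace Z] [MeasurableSingletonClass Z]
  {f : (ℕ → State) → Z}

lemma lintegral_occupation_one [IsProbabilityMeasure P] (hP : IsInvariantLaw ψ φ P)
    (hf : Measurable f) (z : Z) :
    ∫⁻ w, occupation f z 1 w ∂P = P {w | zeta f w 0 = z} := by
  classical
  have hm := measurable_zeta_indicator (A := A) hf z
  have hm0 : Measurable fun w : Path A => zeta f w 0 :=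
    (measurable_zeta hf).comp (measurable_id.prodMk measurable_const)
  have hS : MeasurableSet {w : Path A | zeta f w 0 = z} := hm0 (measurableSet_singleton z)
  have hs : ∀ s ∈ Set.Ioc (0 : ℝ) 1, ∫⁻ w, (if zeta f w s = z then (1 : ℝ≥0∞) else 0) ∂P =
      P {w | zeta f w 0 = z} := by
    intro s hs
    have h1 := (hP.measurePreserving_shift hs.1.le).lintegral_comp
      (f := fun w => if zeta f w 0 = z then (1 : ℝ≥0∞) else 0)
      (hm.comp (measurable_id.prodMk measurable_const))
    simp only [zeta_shift, add_zero] at h1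
    rw [h1, ← lintegral_indicator_one hS]
    rfl
  simp only [occupation]
  rw [lintegral_lintegral_swap hm.aemeasurable, setLIntegral_congr_fun measurableSet_Ioc hs]
  simp

open Classical in
/-- The rate at which `e` leads the observed process from `z` to `z'` at time `0`, as a function of
the trajectory and of the arrival rates. -/
noncomputable def jumpRate (f : (ℕ → State) → Z) (z z' : Z) (e : Event A)
    (q : Path A × (Event A → ℝ≥0)) : ℝ≥0∞ :=
  if f (q.1.history 0) = z ∧ f (prepend e.state (q.1.history 0)) = z' then q.2 e else 0

lemma measurable_jumpRate (hf : Measurable f) (z z' : Z) (e : Event A) :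
    Measurable (jumpRate f z z' e) := by
  have h : Measurable fun q : Path A × (Event A → ℝ≥0) => q.1.history 0 :=
    Path.measurable_history_index.comp (measurable_fst.prodMk measurable_const)
  exact Measurable.ite (((hf.comp h) (measurableSet_singleton z)).inter
    ((hf.comp ((measurable_prepend _).comp h)) (measurableSet_singleton z')))
    ((measurable_pi_apply e).comp measurable_snd).coe_nnreal_ennreal measurable_const

/-- The mean number of transitions per unit of time, by the definition of the intensity applied to
the predictable indicators that `e` leads from `z` to `z'`, and by stationarity. -/
lemma lintegral_jumpCount_one [IsProbabilityMeasure P] (hP : IsInvariantLaw ψ φ P)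
    (hψ : ∀ e u, Measurable (Function.uncurry (ψ e u)))
    (hφ : ∀ e u x, Measurable (fun s => φ e u s x)) (hf : Measurable f) (z z' : Z) :
    ∫⁻ w, jumpCount f z z' 1 w ∂P =
      ∑' e : Event A, ∫⁻ w, jumpRate f z z' e (w, intensity ψ φ w 0) ∂P := by
  classical
  set C : Event A → ℝ≥0 → Path A → ℝ≥0∞ := fun e s w =>
    if s ≤ 1 ∧ f (w.history (w.leftIdx s)) = z ∧
      f (prepend e.state (w.history (w.leftIdx s))) = z' then 1 else 0 with hC
  have hpred : ∀ e, Measurable[(Path.filtration A).predictable] (Function.uncurry (C e)) := by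
    intro e
    have h1 : MeasurableSet[(Path.filtration A).predictable] {p : ℝ≥0 × Path A | p.1 ≤ 1} := by
      have : {p : ℝ≥0 × Path A | p.1 ≤ 1} = (Set.Ioi 1 ×ˢ Set.univ)ᶜ := by
        ext p; simp
      rw [this]
      exact (measurableSet_predictable_Ioi_prod MeasurableSet.univ).compl
    have h2 := hf.comp (Path.measurable_predictable_history (A := A))
    have h3 := hf.comp ((measurable_prepend e.state).comp
      (Path.measurable_predictable_history (A := A)))
    exact Measurable.ite (h1.inter ((h2 (measurableSet_singleton z)).inter
      (h3 (measurableSet_singleton z')))) measurable_const measurable_const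
  -- at the time of the `i`-th event, the history strictly before is the one up to `i - 1`
  have hsplit : ∀ w : Path A, jumpCount f z z' 1 w =
      ∑' e : Event A, ∑' i : ℤ,
        if 0 < w.T i ∧ w.X i = e then C e (w.T i).toNNReal w else 0 := by
    intro w
    rw [ENNReal.tsum_comm, jumpCount]
    refine tsum_congr fun i => ?_
    rw [tsum_eq_single (w.X i) fun e he => if_neg fun h => he h.2.symm]
    by_cases hT : 0 < w.T i
    · have h1 : w.history i = prepend (w.X i).state (w.history (i - 1)) :=
        w.history_eq_prepend i
      simp only [hT, hC, true_and, and_self, if_true, Real.coe_toNNReal _ hT.le, Path.leftIdx_T,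
        Real.toNNReal_le_one, zetaAt, h1]
    · simp [hT]
  have hmeas : ∀ e, Measurable fun w : Path A => ∑' i : ℤ,
      if 0 < w.T i ∧ w.X i = e then C e (w.T i).toNNReal w else 0 := by
    intro e
    refine Measurable.tsum fun i => ?_
    have h0 : Measurable fun w : Path A => if 0 < w.T i ∧ w.X i = e then (if w.T i ≤ 1 ∧
        f (w.history (i - 1)) = z ∧ f (prepend e.state (w.history (i - 1))) = z'
        then (1 : ℝ≥0∞) else 0) else 0 := by
      have hh : Measurable fun w : Path A => w.history (i - 1) :=
        Path.measurable_history_index.comp (measurable_id.prodMk measurable_const)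
      refine Measurable.ite ((measurableSet_lt measurable_const (Path.measurable_T i)).inter
        (Path.measurable_X i (measurableSet_singleton e))) (Measurable.ite
        ((measurableSet_le (Path.measurable_T i) measurable_const).inter
          (((hf.comp hh) (measurableSet_singleton z)).inter
          ((hf.comp ((measurable_prepend _).comp hh)) (measurableSet_singleton z'))))
        measurable_const measurable_const) measurable_const
    convert! h0 using 2 with w
    by_cases hT : 0 < w.T i
    · simp only [hT, hC, true_and, Real.coe_toNNReal _ hT.le, Path.leftIdx_T,
        Real.toNNReal_le_one]
    · simp [hT]
  simp only [hsplit]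
  rw [lintegral_tsum fun e => (hmeas e).aemeasurable]
  refine tsum_congr fun e => ?_
  rw [hP.hasIntensity e (C e) (hpred e)]
  have hrate : Measurable fun p : Path A × ℝ =>
      if f (p.1.history (p.1.idx p.2)) = z ∧ f (prepend e.state (p.1.history (p.1.idx p.2))) = z'
        then (intensity ψ φ p.1 p.2 e : ℝ≥0∞) else 0 := by
    have hh : Measurable fun p : Path A × ℝ => p.1.history (p.1.idx p.2) :=
      Path.measurable_history_index.comp (measurable_fst.prodMk Path.measurable_idx)
    exact Measurable.ite (((hf.comp hh) (measurableSet_singleton z)).inter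
      ((hf.comp ((measurable_prepend _).comp hh)) (measurableSet_singleton z')))
      (measurable_intensity hψ hφ e).coe_nnreal_ennreal measurable_const
  -- almost every time is not the time of an event, so that left limits can be dropped
  have hinner : ∀ w : Path A,
      ∫⁻ s in Set.Ioi (0 : ℝ), C e s.toNNReal w * (intensity ψ φ w s e : ℝ≥0∞) =
        ∫⁻ s in Set.Ioc (0 : ℝ) 1,
          if f (w.history (w.idx s)) = z ∧ f (prepend e.state (w.history (w.idx s))) = z'
            then (intensity ψ φ w s e : ℝ≥0∞) else 0 := by
    intro w
    rw [← Set.Ioi_inter_Iic, Set.inter_comm, ← Measure.restrict_restrict measurableSet_Iic,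
      ← lintegral_indicator measurableSet_Iic]
    have hnull : ∀ᵐ s ∂(volume.restrict (Set.Ioi (0 : ℝ))), s ∉ Set.range w.T :=
      ae_restrict_of_ae ((Set.countable_range w.T).ae_notMem _)
    refine lintegral_congr_ae ?_
    filter_upwards [hnull, ae_restrict_mem measurableSet_Ioi] with s hs hs0
    have hs0' : 0 ≤ s := le_of_lt hs0
    simp only [hC, Real.coe_toNNReal _ hs0', w.leftIdx_eq_idx hs, Real.toNNReal_le_one,
      Set.indicator_apply, Set.mem_Iic]
    by_cases h1 : s ≤ 1 <;> simp [h1]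
  simp only [hinner]
  rw [lintegral_lintegral_swap hrate.aemeasurable,
    setLIntegral_congr_fun (g := fun _ => ∫⁻ w, jumpRate f z z' e (w, intensity ψ φ w 0) ∂P)
      measurableSet_Ioc fun s hs => ?_]
  · simp
  · have h := ((hP.invariant s hs.1.le).comp (measurable_jumpRate hf z z' e)).lintegral_eq
    simpa only [Function.comp_def, jumpRate, Path.history_shift, zero_add] using h

/-- Conditioning on `ζ_0 = z` divides the mean number of transitions by the probability of `z`. -/
lemma Q_eq_div [IsProbabilityMeasure P] (hP : IsInvariantLaw ψ φ P)
    (hψ : ∀ e u, Measurable (Function.uncurry (ψ e u)))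
    (hφ : ∀ e u x, Measurable (fun s => φ e u s x)) (hf : Measurable f) (z z' : Z) :
    Q f ψ φ P z z' = (∫⁻ w, jumpCount f z z' 1 w ∂P) / P {w | zeta f w 0 = z} := by
  classical
  have hS : MeasurableSet {w : Path A | zeta f w 0 = z} :=
    ((measurable_zeta hf).comp (measurable_id.prodMk measurable_const)) (measurableSet_singleton z)
  rw [lintegral_jumpCount_one hP hψ hφ hf, Q, div_eq_mul_inv, mul_comm, ← ENNReal.tsum_mul_left]
  refine tsum_congr fun e => ?_
  rw [ProbabilityTheory.cond, lintegral_smul_measure, ← lintegral_indicator hS, smul_eq_mul]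
  congr 1
  refine lintegral_congr fun w => ?_
  simp only [Set.indicator_apply, Set.mem_ofPred_eq, zeta, zetaAt, leadingTo, Path.idx_zero,
    jumpRate, ← ite_and]

end Mean

end OrderBook

theorem mainTheorem6 {A : ℕ}
    (ψ : OrderBook.Event A → OrderBook.State → ℝ → ℝ≥0 → ℝ≥0)
    (φ : OrderBook.Event A → OrderBook.State → ℝ → OrderBook.Event A → ℝ≥0)
    (hψ : ∀ e u, Measurable (Function.uncurry (ψ e u)))
    (hφ : ∀ e u x, Measurable (fun s => φ e u s x))
    (P : Measure (OrderBook.Path A)) [IsProbabilityMeasure P]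
    (hP : OrderBook.IsInvariantLaw ψ φ P)
    (hunique : ∀ P' : Measure (OrderBook.Path A), IsProbabilityMeasure P' →
      OrderBook.IsInvariantLaw ψ φ P' → P' = P)
    {Z : Type*} [Countable Z] [MeasurableSpace Z] [MeasurableSingletonClass Z]
    (f : (ℕ → OrderBook.State) → Z) (hf : Measurable f)
    (z z' : Z) (hzz' : z ≠ z') (hz : P {w | OrderBook.zeta f w 0 = z} ≠ 0) :
    ∀ᵐ w ∂P, Tendsto
      (fun t : ℝ => ENNReal.ofReal
        (OrderBook.transitions f z z' w t / OrderBook.timeSpent f z w t))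
      atTop (𝓝 (OrderBook.Q f ψ φ P z z')) := by
  classical
  have hJ := OrderBook.ae_tendsto_div_of_cocycle (hP.measurePreserving_shift zero_le_one)
    (fun B hB hinv => hP.eq_zero_or_ae_mem hunique hB hinv)
    (OrderBook.measurable_jumpCount hf z z') (OrderBook.jumpCount_ne_top f z z')
    (OrderBook.jumpCount_zero f z z') fun s t w hs ht => OrderBook.jumpCount_add f z z' hs ht w
  have hO := OrderBook.ae_tendsto_div_of_cocycle (hP.measurePreserving_shift zero_le_one)
    (fun B hB hinv => hP.eq_zero_or_ae_mem hunique hB hinv)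
    (OrderBook.measurable_occupation hf z) (OrderBook.occupation_ne_top f z)
    (OrderBook.occupation_zero f z) fun s t w hs ht => OrderBook.occupation_add f z hs ht w
  rw [OrderBook.lintegral_occupation_one hP hf] at hO
  rw [OrderBook.Q_eq_div hP hψ hφ hf]
  filter_upwards [hJ, hO] with w hJw hOw
  -- both functionals are constant between two events, so time runs along the times of events
  have hT : Tendsto (fun t => w.T (w.leftIdx t)) atTop atTop :=
    w.tendsto_atTop.comp w.tendsto_leftIdx
  set c : ℝ≥0∞ := if OrderBook.zetaAt f w 0 = z then ENNReal.ofReal (- w.T 0) else 0 with hc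
  have hctop : c ≠ ⊤ := by rw [hc]; split_ifs <;> simp
  have hcz : Tendsto (fun t : ℝ => c / ENNReal.ofReal t) atTop (𝓝 0) := by
    simpa using ENNReal.Tendsto.const_div ENNReal.tendsto_ofReal_atTop (Or.inr hctop)
  have hOc : Tendsto (fun t : ℝ => (OrderBook.occupation f z t w + c) / ENNReal.ofReal t) atTop
      (𝓝 (P {w | OrderBook.zeta f w 0 = z})) := by
    simpa only [ENNReal.add_div, add_zero] using hOw.add hcz
  have hlim := (ENNReal.Tendsto.div hJw (Or.inr hz) hOc (Or.inl (measure_ne_top _ _))).comp hT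
  refine hlim.congr' ?_
  filter_upwards [w.tendsto_leftIdx.eventually_ge_atTop 1, hT.eventually_gt_atTop 0,
    (hOc.comp hT).eventually (lt_mem_nhds (pos_iff_ne_zero.2 hz))] with t h1 h2 h3
  have hts := OrderBook.timeSpent_eq_occupation f z w h1
  rw [← hc] at hts
  simp only [Function.comp_apply, ← hts, ← OrderBook.transitions_eq_jumpCount] at h3 ⊢
  have hpos : 0 < OrderBook.timeSpent f z w t := by
    by_contra hle
    rw [ENNReal.ofReal_of_nonpos (not_lt.1 hle)] at h3
    simp at h3
  rw [← ENNReal.ofReal_div_of_pos h2, ← ENNReal.ofReal_div_of_pos h2,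
    ← ENNReal.ofReal_div_of_pos (div_pos hpos h2), div_div_div_cancel_right₀ h2.ne']
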